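/- Use the Fourier transform $\mathcal F(f)(\xi)=\int_{\mathbb R}f(x)e^{-ix\xi}\,dx$, extended by duality to tempered distributions. Let $m(\xi)=\left(\frac{\tanh\xi}{\xi}\right)^{1/2}$ for $\xi\neq0$, $m(0)=1$, let $K=\mathcal F^{-1}(m)$ and, for $c>1$, let $H_c=\mathcal F^{-1}\!\left(\frac{m}{c-m}\right)$; these are real functions determined up to null sets. Call $\delta_c\in(0,\frac{\pi}{2})$ a decay rate of $H_c$ if $x\mapsto e^{\delta_c|x|}\,x\,H_c(x)$ belongs to $L^2(\mathbb R)$. **Theorem (Exponential decay).** Let $c>1$. Then $H_c$ has a decay rate. Moreover, let $\delta_c$ be any decay rate of $H_c$, and let $\phi:\mathbb R\to\mathbb R$ be a continuous and bounded solution of the steady Whitham equation with speed $c$, that is, $\phi$ satisfies pointwise on $\mathbb R$ $$-c\,\phi+\phi^2+K*\phi=0\qquad\text{or its reformulation}\qquad \phi\,(c-\phi)=H_c*\phi^2 .$$ If $\phi(x)\to0$ as $|x|\to\infty$, then there exists $\nu$ with $0<\nu<\delta_c$ such that $$x\mapsto e^{\nu|x|}\phi(x)\quad\text{belongs to}\quad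 L^1(\mathbb R)\cap L^\infty(\mathbb R).$$ -/

import Mathlib

namespace Whitham

noncomputable section

open MeasureTheory

/-- The Fourier transform in the normalization `F(f)(ξ) = ∫ f(x) e^{-i x ξ} dx`,
obtained from Mathlib's `∫ f(x) e^{-2 π i x ξ} dx` by rescaling the frequency. -/
def fourier (f : ℝ → ℂ) (ξ : ℝ) : ℂ :=
  FourierTransform.fourier f (ξ / (2 * Real.pi))

theorem fourier_eq_integral (f : ℝ → ℂ) (ξ : ℝ) :
    fourier f ξ = ∫ x : ℝ, Complex.exp (-(Complex.I * x * ξ)) * f x := by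
  have hpi : (Real.pi : ℂ) ≠ 0 := by exact_mod_cast Real.pi_ne_zero
  simp only [fourier, Real.fourier_real_eq_integral_exp_smul, smul_eq_mul]
  congr 1
  ext x
  congr 2
  push_cast
  field_simp

/-- The function `f` is the inverse Fourier transform of `s` in the sense of tempered
distributions: `F(f) = s`, that is, `⟨f, F(ψ)⟩ = ⟨s, ψ⟩` for every Schwartz function `ψ`.
This determines `f` up to a null set. -/
def IsInverseFourier (s f : ℝ → ℝ) : Prop :=
  ∀ ψ : SchwartzMap ℝ ℂ,
    Integrable (fun x : ℝ => (f x : ℂ) * fourier ψ x) ∧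
    Integrable (fun ξ : ℝ => (s ξ : ℂ) * ψ ξ) ∧
    ∫ x : ℝ, (f x : ℂ) * fourier ψ x = ∫ ξ : ℝ, (s ξ : ℂ) * ψ ξ

open Classical in
/-- The inverse Fourier transform `F⁻¹(s)` of a real even symbol `s`, as a real function
(a representative of its almost-everywhere class; only its class is ever used). -/
def inverseFourier (s : ℝ → ℝ) : ℝ → ℝ :=
  if h : ∃ f : ℝ → ℝ, IsInverseFourier s f then h.choose else 0

/-- The Whitham symbol `m(ξ) = (tanh ξ / ξ)^{1/2}`, with `m(0) = 1`. -/
def m (ξ : ℝ) : ℝ :=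
  if ξ = 0 then 1 else Real.sqrt (Real.tanh ξ / ξ)

/-- The Whitham kernel `K = F⁻¹(m)`. -/
def K : ℝ → ℝ := inverseFourier m

/-- The kernel `H_c = F⁻¹(m / (c - m))`. -/
def H (c : ℝ) : ℝ → ℝ := inverseFourier fun ξ => m ξ / (c - m ξ)

/-- The convolution `(f * g)(x) = ∫ f(y) g(x - y) dy` of real functions on the line. -/
def conv (f g : ℝ → ℝ) : ℝ → ℝ :=
  convolution f g (ContinuousLinearMap.mul ℝ ℝ) volume

/-- A solution of `-c φ + φ² + K * φ = 0`: continuous, bounded, satisfying it pointwise. -/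
structure IsSteadySolution (c : ℝ) (φ : ℝ → ℝ) : Prop where
  continuous : Continuous φ
  bounded : ∃ C : ℝ, ∀ x : ℝ, |φ x| ≤ C
  equation : ∀ x : ℝ, -c * φ x + φ x ^ 2 + conv K φ x = 0

/-- A solution of the form `φ (c - φ) = H_c * φ²` of the steady Whitham equation:
continuous, bounded, satisfying it pointwise. -/
structure IsConvolutionSolution (c : ℝ) (φ : ℝ → ℝ) : Prop where
  continuous : Continuous φ
  bounded : ∃ C : ℝ, ∀ x : ℝ, |φ x| ≤ C
  equation : ∀ x : ℝ, φ x * (c - φ x) = conv (H c) (fun y => φ y ^ 2) x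

/-- `δ ∈ (0, π/2)` is a decay rate of `H_c`: the function `x ↦ e^{δ|x|} x H_c(x)` is in `L²`. -/
def IsDecayRate (c δ : ℝ) : Prop :=
  0 < δ ∧ δ < Real.pi / 2 ∧
    MemLp (fun x : ℝ => Real.exp (δ * |x|) * (x * H c x)) 2 volume

end

end Whitham

namespace Whitham

noncomputable section

open MeasureTheory Filter Set
open scoped Topology

/-! The decay of `φ` comes from the decay of `H_c` and the quadratic nonlinearity. Suppose `e^{δ|x|}
H_c` is integrable. Far out, `|φ| ≤ c/2`, so `φ (c - φ) = H_c * φ²` gives `|φ| ≤ (2/c) |H_c * φ²|`.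
Multiply by a truncated weight `w = min(e^{δ|x|}, n)`, which satisfies `w(x) ≤ e^{δ|y|} w(x - y)`.
One factor of `φ²` is small at infinity, so the right side is at most a constant plus half of `sup
w|φ|`; absorbing that half bounds `w|φ|` independently of `n` (`exp_mul_abs_le_of_conv_sq`). Any
smaller exponent then puts the weighted `φ` in `L¹ ∩ L^∞`.

The kernel estimate rests on holomorphy: if a symbol extends to a strip with decay `|Re z|^{-3/2}`,
shifting the contour of the inversion integral produces exponential decay (`exists_isExpKernel`).
The symbol `m` extends, because `tanh z / z` has positive real part for `|Im z| < π/4`, but it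
decays only like `|ξ|^{-1/2}`, so its inversion integral is not absolutely convergent. This is
repaired by subtracting `(2π)^{-1/2}` times the explicit transform of `|x|^{-1/2} e^{-|x|}`: the
remainder has order `|ξ|^{-3/2}`. For `m / (c - m)` the expansion `m/c + m²/c² + m³/(c²(c - m))`
leaves two terms built from `K` and `K * K`, and a remainder of order `|ξ|^{-3/2}`, holomorphic in a
strip so thin that `|m| < c` there.

The two forms of the equation are linked by `H_c * K = c H_c - K`, read off from the symbols:
convolving `K * φ = c φ - φ²` with `H_c` gives `K * φ = H_c * φ²`. -/

/-! ### Algebra of exponentially decaying kernels -/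

/-- The function `h` decays exponentially at rate `δ` in `L¹`, its product with `x` is bounded by a
multiple of `e^{-δ|x|}`, and its Fourier transform is `s`. -/
structure IsExpKernel (δ : ℝ) (h s : ℝ → ℝ) : Prop where
  pos : 0 < δ
  integrable_exp : Integrable fun x => Real.exp (δ * |x|) * h x
  bounded : ∃ C, ∀ x, |Real.exp (δ * |x|) * (x * h x)| ≤ C
  fourier_eq : ∀ ξ, fourier (fun x => (h x : ℂ)) ξ = s ξ

theorem integrable_exp_mul_mono {δ δ' : ℝ} (hle : δ' ≤ δ) {h : ℝ → ℝ}
    (hi : Integrable fun x => Real.exp (δ * |x|) * h x) :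
    Integrable fun x => Real.exp (δ' * |x|) * h x := by
  have := hi.bdd_mul (c := 1) (f := fun x => Real.exp ((δ' - δ) * |x|))
    (Continuous.aestronglyMeasurable (by fun_prop)) (ae_of_all _ fun x => by
      rw [Real.norm_eq_abs, Real.abs_exp, Real.exp_le_one_iff]
      exact mul_nonpos_of_nonpos_of_nonneg (by linarith) (abs_nonneg x))
  refine this.congr (ae_of_all _ fun x => ?_)
  simp only
  rw [← mul_assoc, ← Real.exp_add]
  ring_nf

theorem integrable_comp_abs {f : ℝ → ℝ} (hf : IntegrableOn f (Ioi 0)) :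
    Integrable fun x => f |x| := by
  rw [← integrableOn_univ, ← Iic_union_Ioi (a := (0 : ℝ)), integrableOn_union]
  constructor
  · have h1 : IntegrableOn (fun x => f (-x)) (Iio 0) := by
      have := (Measure.measurePreserving_neg (volume : Measure ℝ)).integrableOn_comp_preimage
        (Homeomorph.neg ℝ).measurableEmbedding (f := f) (s := Ioi 0)
      simpa [Function.comp_def] using this.2 hf
    rw [integrableOn_Iic_iff_integrableOn_Iio]
    exact h1.congr_fun (fun x hx => by simp only [abs_of_neg (mem_Iio.1 hx)]) measurableSet_Iio
  · exact hf.congr_fun (fun x hx => by simp only [abs_of_pos (mem_Ioi.1 hx)]) measurableSet_Ioi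

theorem integrable_exp_neg_mul_abs {δ : ℝ} (hδ : 0 < δ) :
    Integrable fun x : ℝ => Real.exp (-δ * |x|) :=
  integrable_comp_abs (f := fun x => Real.exp (-δ * x))
    (integrableOn_exp_mul_Ioi (neg_neg_of_pos hδ) 0)

theorem conv_apply (f g : ℝ → ℝ) (x : ℝ) :
    conv f g x = ∫ y, f y * g (x - y) := rfl

namespace IsExpKernel

variable {δ δ' : ℝ} {h h₁ h₂ s s₁ s₂ : ℝ → ℝ}

theorem mono (hh : IsExpKernel δ h s) (hpos : 0 < δ') (hle : δ' ≤ δ) : IsExpKernel δ' h s where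
  pos := hpos
  integrable_exp := integrable_exp_mul_mono hle hh.integrable_exp
  bounded := by
    obtain ⟨C, hC⟩ := hh.bounded
    refine ⟨C, fun x => le_trans ?_ (hC x)⟩
    rw [abs_mul, abs_mul (Real.exp _), Real.abs_exp, Real.abs_exp]
    gcongr
  fourier_eq := hh.fourier_eq

theorem integrable (hh : IsExpKernel δ h s) : Integrable h := by
  simpa using integrable_exp_mul_mono hh.pos.le hh.integrable_exp

theorem add (hh₁ : IsExpKernel δ h₁ s₁) (hh₂ : IsExpKernel δ h₂ s₂) :
    IsExpKernel δ (fun x => h₁ x + h₂ x) (fun ξ => s₁ ξ + s₂ ξ) where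
  pos := hh₁.pos
  integrable_exp := by
    simp only [mul_add]
    exact hh₁.integrable_exp.add hh₂.integrable_exp
  bounded := by
    obtain ⟨C₁, hC₁⟩ := hh₁.bounded
    obtain ⟨C₂, hC₂⟩ := hh₂.bounded
    refine ⟨C₁ + C₂, fun x => ?_⟩
    rw [mul_add, mul_add]
    exact (abs_add_le _ _).trans (add_le_add (hC₁ x) (hC₂ x))
  fourier_eq ξ := by
    have h1 := hh₁.fourier_eq ξ
    have h2 := hh₂.fourier_eq ξ
    rw [fourier_eq_integral] at h1 h2 ⊢
    push_cast
    rw [← h1, ← h2, ← integral_add]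
    · simp only [mul_add]
    · refine hh₁.integrable.ofReal.bdd_mul (c := 1)
        (Continuous.aestronglyMeasurable (by fun_prop)) (ae_of_all _ fun x => ?_)
      rw [Complex.norm_exp]
      simp
    · refine hh₂.integrable.ofReal.bdd_mul (c := 1)
        (Continuous.aestronglyMeasurable (by fun_prop)) (ae_of_all _ fun x => ?_)
      rw [Complex.norm_exp]
      simp

theorem const_mul (hh : IsExpKernel δ h s) (a : ℝ) :
    IsExpKernel δ (fun x => a * h x) (fun ξ => a * s ξ) where
  pos := hh.pos
  integrable_exp := (hh.integrable_exp.const_mul a).congr (ae_of_all _ fun x => by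
    simp only; ring)
  bounded := by
    obtain ⟨C, hC⟩ := hh.bounded
    refine ⟨|a| * C, fun x => ?_⟩
    rw [show Real.exp (δ * |x|) * (x * (a * h x)) = a * (Real.exp (δ * |x|) * (x * h x)) by ring,
      abs_mul]
    exact mul_le_mul_of_nonneg_left (hC x) (abs_nonneg a)
  fourier_eq ξ := by
    have h1 := hh.fourier_eq ξ
    rw [fourier_eq_integral] at h1 ⊢
    push_cast
    rw [← h1, ← integral_const_mul]
    congr 1
    ext x
    ring

/-- Since `|x| ≤ |y| + |x - y|`, the exponential weight is submultiplicative and can be distributed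
over the two factors of a convolution. -/
theorem exp_mul_abs_conv_le (f g : ℝ → ℝ) (hδ : 0 ≤ δ) (x y : ℝ) :
    Real.exp (δ * |x|) * |f y * g (x - y)| ≤
      |Real.exp (δ * |y|) * f y| * |Real.exp (δ * |x - y|) * g (x - y)| := by
  rw [abs_mul, abs_mul, abs_mul, Real.abs_exp, Real.abs_exp]
  have : Real.exp (δ * |x|) ≤ Real.exp (δ * |y|) * Real.exp (δ * |x - y|) := by
    rw [← Real.exp_add, ← mul_add]
    gcongr
    calc |x| = |y + (x - y)| := by ring_nf
      _ ≤ _ := abs_add_le _ _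
  calc _ ≤ (Real.exp (δ * |y|) * Real.exp (δ * |x - y|)) * (|f y| * |g (x - y)|) := by gcongr
    _ = _ := by ring

theorem integrable_exp_conv {f g : ℝ → ℝ} (hδ : 0 ≤ δ)
    (hf : Integrable fun x => Real.exp (δ * |x|) * f x)
    (hg : Integrable fun x => Real.exp (δ * |x|) * g x) :
    Integrable fun x => Real.exp (δ * |x|) * conv f g x := by
  have hf0 : Integrable f := by simpa using integrable_exp_mul_mono hδ hf
  have hg0 : Integrable g := by simpa using integrable_exp_mul_mono hδ hg
  have hfg := (hf.norm.integrable_convolution (ContinuousLinearMap.mul ℝ ℝ) hg.norm)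
  have hex := (hf.norm.ae_convolution_exists (ContinuousLinearMap.mul ℝ ℝ) hg.norm)
  refine hfg.mono' ?_ ?_
  · exact (Continuous.aestronglyMeasurable (by fun_prop)).mul
      (hf0.integrable_convolution (ContinuousLinearMap.mul ℝ ℝ) hg0).aestronglyMeasurable
  · filter_upwards [hex] with x hx
    rw [conv_apply, ← integral_const_mul]
    refine norm_integral_le_of_norm_le hx (ae_of_all _ fun y => ?_)
    have := exp_mul_abs_conv_le f g hδ x y
    rw [norm_mul, Real.norm_eq_abs, Real.abs_exp]
    simpa using this

theorem conv (hh₁ : IsExpKernel δ h₁ s₁) (hh₂ : IsExpKernel δ h₂ s₂) :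
    IsExpKernel δ (Whitham.conv h₁ h₂) (fun ξ => s₁ ξ * s₂ ξ) where
  pos := hh₁.pos
  integrable_exp := integrable_exp_conv hh₁.pos.le hh₁.integrable_exp hh₂.integrable_exp
  bounded := by
    obtain ⟨C₁, hC₁⟩ := hh₁.bounded
    obtain ⟨C₂, hC₂⟩ := hh₂.bounded
    have hi₁ := hh₁.integrable_exp.norm
    have hi₂ := hh₂.integrable_exp.norm
    refine ⟨C₁ * (∫ y, ‖Real.exp (δ * |y|) * h₂ y‖) + C₂ * ∫ y, ‖Real.exp (δ * |y|) * h₁ y‖,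
      fun x => ?_⟩
    have hb : Integrable fun y => C₁ * ‖Real.exp (δ * |x - y|) * h₂ (x - y)‖ +
        C₂ * ‖Real.exp (δ * |y|) * h₁ y‖ :=
      ((hi₂.comp_sub_left x).const_mul C₁).add (hi₁.const_mul C₂)
    have hval : ∫ y, (C₁ * ‖Real.exp (δ * |x - y|) * h₂ (x - y)‖ +
        C₂ * ‖Real.exp (δ * |y|) * h₁ y‖) =
        C₁ * (∫ y, ‖Real.exp (δ * |y|) * h₂ y‖) + C₂ * ∫ y, ‖Real.exp (δ * |y|) * h₁ y‖ := by
      rw [integral_add ((hi₂.comp_sub_left x).const_mul C₁) (hi₁.const_mul C₂),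
        integral_const_mul, integral_const_mul,
        integral_sub_left_eq_self (fun y => ‖Real.exp (δ * |y|) * h₂ y‖)]
    rw [← hval, conv_apply, ← integral_const_mul, ← integral_const_mul]
    rw [← Real.norm_eq_abs]
    refine norm_integral_le_of_norm_le hb (ae_of_all _ fun y => ?_)
    -- Splitting `x = y + (x - y)` gives each factor in turn the role of the one bounded after
    -- multiplication by its variable; the other factor is integrated.
    have e1 := exp_mul_abs_conv_le (fun y => y * h₁ y) h₂ hh₁.pos.le x y
    have e2 := exp_mul_abs_conv_le h₁ (fun y => y * h₂ y) hh₁.pos.le x y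
    simp only [Real.norm_eq_abs]
    calc |Real.exp (δ * |x|) * (x * (h₁ y * h₂ (x - y)))|
        = Real.exp (δ * |x|) * |(y * h₁ y) * h₂ (x - y) + h₁ y * ((x - y) * h₂ (x - y))| := by
          rw [abs_mul, Real.abs_exp]; ring_nf
      _ ≤ Real.exp (δ * |x|) * |(y * h₁ y) * h₂ (x - y)| +
          Real.exp (δ * |x|) * |h₁ y * ((x - y) * h₂ (x - y))| := by
          rw [← mul_add]; gcongr; exact abs_add_le _ _
      _ ≤ _ := by
          refine add_le_add (e1.trans ?_) (e2.trans ?_)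
          · gcongr; exact hC₁ y
          · rw [mul_comm]; gcongr; exact hC₂ (x - y)
  fourier_eq ξ := by
    have h1 := hh₁.fourier_eq ξ
    have h2 := hh₂.fourier_eq ξ
    have := Real.fourier_mul_convolution_eq (hh₁.integrable.ofReal (𝕜 := ℂ))
      (hh₂.integrable.ofReal (𝕜 := ℂ)) (ξ / (2 * Real.pi))
    push_cast
    rw [← h1, ← h2]
    have e : (fun x => ((Whitham.conv h₁ h₂ x : ℝ) : ℂ)) =
        convolution (fun x => (h₁ x : ℂ)) (fun x => (h₂ x : ℂ)) (ContinuousLinearMap.mul ℂ ℂ)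
          volume := by
      ext x
      rw [conv_apply, ← integral_complex_ofReal]
      simp [convolution_def]
    unfold fourier
    rw [e]
    exact this

/-- Giving up half of the rate leaves a factor `e^{-δ|x|/2}`, whose square is integrable. -/
theorem memLp_two (hh : IsExpKernel δ h s) :
    MemLp (fun x : ℝ => Real.exp (δ / 2 * |x|) * (x * h x)) 2 volume := by
  obtain ⟨C, hC⟩ := hh.bounded
  have hC0 : 0 ≤ C := (abs_nonneg _).trans (hC 0)
  have hm : AEStronglyMeasurable (fun x : ℝ => Real.exp (δ / 2 * |x|) * (x * h x)) volume :=
    (Continuous.aestronglyMeasurable (by fun_prop)).mul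
      ((Continuous.aestronglyMeasurable (by fun_prop)).mul hh.integrable.aestronglyMeasurable)
  rw [memLp_two_iff_integrable_sq hm]
  refine ((integrable_exp_neg_mul_abs hh.pos).const_mul (C ^ 2)).mono' (hm.pow 2) (ae_of_all _ fun x => ?_)
  have h1 : Real.exp (δ / 2 * |x|) * (x * h x) =
      Real.exp (-(δ / 2) * |x|) * (Real.exp (δ * |x|) * (x * h x)) := by
    rw [← mul_assoc (Real.exp _) (Real.exp _), ← Real.exp_add]; ring_nf
  rw [h1, mul_pow, ← Real.exp_nat_mul, Real.norm_eq_abs, abs_mul, Real.abs_exp, abs_pow, mul_comm,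
    show ((2 : ℕ) : ℝ) * (-(δ / 2) * |x|) = -δ * |x| by push_cast; ring]
  gcongr
  exact hC x

end IsExpKernel

/-! ### Fourier duality and uniqueness of the inverse transform -/

theorem integral_fourier_mul_eq_of_integrable {f g : ℝ → ℂ} (hf : Integrable f)
    (hg : Integrable g) : ∫ ξ, fourier f ξ * g ξ = ∫ x, f x * fourier g x := by
  simp only [fourier_eq_integral]
  have hint : Integrable (fun p : ℝ × ℝ => Complex.exp (-(Complex.I * p.2 * p.1)) * (f p.2 * g p.1))
      (volume.prod volume) := by
    refine ((hf.mul_prod hg).swap).bdd_mul (c := 1)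
      (Continuous.aestronglyMeasurable (by fun_prop)) (ae_of_all _ fun x => ?_)
    rw [Complex.norm_exp]
    simp
  calc ∫ ξ : ℝ, (∫ x : ℝ, Complex.exp (-(Complex.I * x * ξ)) * f x) * g ξ
      = ∫ ξ : ℝ, ∫ x : ℝ, Complex.exp (-(Complex.I * x * ξ)) * (f x * g ξ) := by
        simp only [← integral_mul_const, mul_assoc]
    _ = ∫ x : ℝ, ∫ ξ : ℝ, Complex.exp (-(Complex.I * x * ξ)) * (f x * g ξ) :=
        integral_integral_swap hint
    _ = _ := by
        congr 1
        ext x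
        rw [← integral_const_mul]
        congr 1
        ext ξ
        rw [show Complex.I * x * ξ = Complex.I * ξ * x by ring]
        ring

theorem norm_fourier_le (f : ℝ → ℂ) (ξ : ℝ) : ‖fourier f ξ‖ ≤ ∫ x, ‖f x‖ := by
  rw [fourier_eq_integral]
  refine (norm_integral_le_integral_norm _).trans (le_of_eq ?_)
  congr 1
  ext x
  rw [norm_mul, Complex.norm_exp]
  simp

theorem continuous_fourier {f : ℝ → ℂ} (hf : Integrable f) : Continuous (fourier f) := by
  have := VectorFourier.fourierIntegral_continuous Real.continuous_fourierChar
    (L := innerₗ ℝ) continuous_inner hf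
  exact this.comp (continuous_id.div_const (2 * Real.pi))

/-- The Fourier transform of a Schwartz function, with the angular frequency normalization, is the
restriction of a Schwartz function. -/
theorem exists_schwartz_fourier_eq (χ : SchwartzMap ℝ ℂ) :
    ∃ ψ : SchwartzMap ℝ ℂ, ∀ x, fourier ψ x = χ x := by
  have hpi : (2 * Real.pi) ≠ 0 := by positivity
  let e : ℝ ≃L[ℝ] ℝ := ContinuousLinearEquiv.unitsEquivAut ℝ (Units.mk0 (2 * Real.pi) hpi)
  refine ⟨FourierTransformInv.fourierInv (SchwartzMap.compCLMOfContinuousLinearEquiv ℂ e χ),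
    fun x => ?_⟩
  rw [fourier, ← SchwartzMap.fourier_coe, FourierTransform.fourier_fourierInv_eq]
  simp only [SchwartzMap.compCLMOfContinuousLinearEquiv_apply, Function.comp_apply]
  congr 1
  simp only [e, ContinuousLinearEquiv.unitsEquivAut_apply, Units.val_mk0]
  field_simp

theorem IsExpKernel.isInverseFourier {δ : ℝ} {h s : ℝ → ℝ} (hh : IsExpKernel δ h s) :
    IsInverseFourier s h := by
  intro ψ
  have hi : Integrable fun x => (h x : ℂ) := hh.integrable.ofReal
  have hs : (fun ξ => (s ξ : ℂ)) = fourier (fun x => (h x : ℂ)) := by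
    ext ξ; exact (hh.fourier_eq ξ).symm
  refine ⟨?_, ?_, ?_⟩
  · exact hi.mul_bdd (c := ∫ x, ‖ψ x‖)
      (continuous_fourier ψ.integrable).aestronglyMeasurable (ae_of_all _ fun x => norm_fourier_le _ _)
  · refine ψ.integrable.bdd_mul (c := ∫ x, ‖(h x : ℂ)‖) ?_ (ae_of_all _ fun x => ?_)
    · rw [hs]
      exact (continuous_fourier hi).aestronglyMeasurable
    · rw [← hh.fourier_eq]
      exact norm_fourier_le _ _
  · rw [← integral_fourier_mul_eq_of_integrable hi ψ.integrable]
    simp only [hh.fourier_eq]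

/-- A smooth bump equal to `1` on a given compact set is the transform of a Schwartz function;
testing against that function gives integrability on the set. -/
theorem IsInverseFourier.locallyIntegrable {s f : ℝ → ℝ} (hf : IsInverseFourier s f) :
    LocallyIntegrable (fun x => (f x : ℂ)) := by
  rw [locallyIntegrable_iff]
  intro k hk
  obtain ⟨R, hR⟩ := hk.isBounded.subset_closedBall 0
  let b : ContDiffBump (0 : ℝ) := ⟨max R 1, max R 1 + 1, by positivity, by linarith⟩
  have hbs : HasCompactSupport fun x => ((b x : ℝ) : ℂ) :=
    b.hasCompactSupport.comp_left Complex.ofReal_zero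
  have hbd : ContDiff ℝ (⊤ : ℕ∞) fun x => ((b x : ℝ) : ℂ) :=
    Complex.ofRealCLM.contDiff.comp b.contDiff
  obtain ⟨ψ, hψ⟩ := exists_schwartz_fourier_eq (hbs.toSchwartzMap hbd)
  refine ((hf ψ).1.integrableOn (s := k)).congr_fun_ae ?_
  refine (ae_restrict_iff' hk.measurableSet).2 (ae_of_all _ fun x hx => ?_)
  have hx1 : x ∈ Metric.closedBall (0 : ℝ) (max R 1) :=
    Metric.closedBall_subset_closedBall (le_max_left _ _) (hR hx)
  have : b x = 1 := b.one_of_mem_closedBall hx1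
  simp only [hψ, HasCompactSupport.toSchwartzMap_toFun]
  simp [this]

/-- Every smooth compactly supported function is a transform of a Schwartz function, so the two
candidates have the same integrals against all of them. -/
theorem IsInverseFourier.ae_eq {s f g : ℝ → ℝ} (hf : IsInverseFourier s f)
    (hg : IsInverseFourier s g) : f =ᵐ[volume] g := by
  have := ae_eq_of_integral_contDiff_smul_eq hf.locallyIntegrable hg.locallyIntegrable
    fun φ hφ hφs => by
      have hbs : HasCompactSupport fun x => ((φ x : ℝ) : ℂ) :=
        hφs.comp_left Complex.ofReal_zero
      have hbd : ContDiff ℝ (⊤ : ℕ∞) fun x => ((φ x : ℝ) : ℂ) :=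
        Complex.ofRealCLM.contDiff.comp hφ
      obtain ⟨ψ, hψ⟩ := exists_schwartz_fourier_eq (hbs.toSchwartzMap hbd)
      have h1 := (hf ψ).2.2.trans (hg ψ).2.2.symm
      simp only [hψ, HasCompactSupport.toSchwartzMap_toFun] at h1
      simpa [mul_comm] using h1
  filter_upwards [this] with x hx
  exact_mod_cast hx

/-- An explicit kernel rules out the default value `0` of `inverseFourier`, and uniqueness
identifies the chosen representative with it. Statements on `K` and `H` pass to explicit kernels
through this. -/
theorem IsExpKernel.ae_eq_inverseFourier {δ : ℝ} {h s : ℝ → ℝ} (hh : IsExpKernel δ h s) :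
    inverseFourier s =ᵐ[volume] h := by
  have hex : ∃ f : ℝ → ℝ, IsInverseFourier s f := ⟨h, hh.isInverseFourier⟩
  rw [inverseFourier, dif_pos hex]
  exact hex.choose_spec.ae_eq hh.isInverseFourier

/-! ### From decay of the kernel to decay of the solution -/

theorem convolutionExistsAt_of_bounded {f φ : ℝ → ℝ} (hf : Integrable f) (hφ : Continuous φ)
    {C : ℝ} (hC : ∀ x, |φ x| ≤ C) (x : ℝ) :
    ConvolutionExistsAt f φ x (ContinuousLinearMap.mul ℝ ℝ) volume :=
  hf.mul_bdd (c := C) (Continuous.aestronglyMeasurable (by fun_prop))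
    (ae_of_all _ fun y => hC (x - y))

/-- If `h * k = c h - k`, then a bounded solution of `-c φ + φ² + k * φ = 0` satisfies
`φ (c - φ) = h * φ²`. -/
theorem mul_sub_eq_conv_sq {c : ℝ} {h k φ : ℝ → ℝ} (hh : Integrable h) (hk : Integrable k)
    (hhk : conv h k =ᵐ[volume] fun x => c * h x - k x) (hφ : Continuous φ)
    {C : ℝ} (hC : ∀ x, |φ x| ≤ C) (heq : ∀ x, -c * φ x + φ x ^ 2 + conv k φ x = 0) (x : ℝ) :
    φ x * (c - φ x) = conv h (fun y => φ y ^ 2) x := by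
  have hC0 : 0 ≤ C := (abs_nonneg _).trans (hC 0)
  have hkφ : (conv k φ) = fun y => c * φ y - φ y ^ 2 := by
    ext y; linarith [heq y]
  -- The triple convolution is evaluated in two ways, by `hhk` and by the equation; the terms `c (h
  -- * φ)` cancel.
  have hassoc : conv (conv h k) φ x = conv h (conv k φ) x := by
    refine convolution_assoc (ContinuousLinearMap.mul ℝ ℝ) (ContinuousLinearMap.mul ℝ ℝ)
      (ContinuousLinearMap.mul ℝ ℝ) (ContinuousLinearMap.mul ℝ ℝ) ?_ hh.aestronglyMeasurable
      hk.aestronglyMeasurable hφ.aestronglyMeasurable ?_ ?_ ?_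
    · intro a b c
      simp [mul_assoc]
    · exact hh.ae_convolution_exists _ hk
    · exact ae_of_all _ fun y => convolutionExistsAt_of_bounded hk.norm hφ.norm
        (C := C) (fun z => by simpa using hC z) y
    · refine convolutionExistsAt_of_bounded hh.norm ?_ (C := (∫ y, ‖k y‖) * C) ?_ x
      · refine BddAbove.continuous_convolution_right_of_integrable _ ?_ hk.norm hφ.norm
        exact ⟨C, by rintro _ ⟨y, rfl⟩; simpa using hC y⟩
      · intro y
        rw [convolution_def, ← integral_mul_const, ← Real.norm_eq_abs]
        refine norm_integral_le_of_norm_le (hk.norm.mul_const C) (ae_of_all _ fun z => ?_)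
        simp only [ContinuousLinearMap.mul_apply', norm_mul, norm_norm]
        gcongr
        exact hC _
  have h1 : conv (conv h k) φ x = c * conv h φ x - conv k φ x := by
    have : conv (conv h k) φ x = ∫ y, (c * h y - k y) * φ (x - y) := by
      rw [conv_apply]
      exact integral_congr_ae (hhk.mono fun y hy => by simp only [hy])
    rw [this, conv_apply, conv_apply, ← integral_const_mul, ← integral_sub]
    · congr 1; ext y; ring
    · exact (convolutionExistsAt_of_bounded hh hφ hC x).const_mul c
    · exact convolutionExistsAt_of_bounded hk hφ hC x
  have h2 : conv h (conv k φ) x = c * conv h φ x - conv h (fun y => φ y ^ 2) x := by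
    rw [hkφ, conv_apply, conv_apply, conv_apply, ← integral_const_mul, ← integral_sub]
    · congr 1; ext y; ring
    · exact (convolutionExistsAt_of_bounded hh hφ hC x).const_mul c
    · refine convolutionExistsAt_of_bounded hh (hφ.pow 2) (C := C ^ 2) (fun y => ?_) x
      rw [Pi.pow_apply, abs_pow]
      gcongr
      exact hC y
  linarith [heq x]

/-- A bounded solution of `φ (c - φ) = h * φ²` that vanishes at infinity inherits the exponential
decay rate of the kernel `h`. -/
theorem exp_mul_abs_le_of_conv_sq {c δ : ℝ} (hc : 0 < c) (hδ : 0 < δ) {h φ : ℝ → ℝ}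
    (hh : Integrable fun x => Real.exp (δ * |x|) * h x)
    {C : ℝ} (hC : ∀ x, |φ x| ≤ C)
    (heq : ∀ x, φ x * (c - φ x) = conv h (fun y => φ y ^ 2) x)
    (hlim : Tendsto φ (cocompact ℝ) (𝓝 0)) :
    ∃ B, ∀ x, Real.exp (δ * |x|) * |φ x| ≤ B := by
  have hC0 : 0 ≤ C := (abs_nonneg _).trans (hC 0)
  set M := ∫ y, ‖Real.exp (δ * |y|) * h y‖ with hM
  have hM0 : 0 ≤ M := integral_nonneg fun _ => norm_nonneg _
  -- Small enough that the feedback coefficient `(2/c) M ε` is at most `1/2`; `M + 1` avoids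
  -- dividing by zero.
  set ε := c / (4 * (M + 1)) with hε
  have hε0 : 0 < ε := by positivity
  have hMε : 2 / c * (M * ε) ≤ 1 / 2 := by
    rw [hε]
    field_simp
    linarith
  obtain ⟨R, hR0, hR⟩ : ∃ R : ℝ, 0 ≤ R ∧ ∀ x, R < |x| → |φ x| ≤ min ε (c / 2) := by
    have h1 : ∀ᶠ x in cocompact ℝ, |φ x| < min ε (c / 2) := by
      have := hlim.abs
      rw [abs_zero] at this
      exact this.eventually_lt_const (by positivity)
    rw [Metric.cobounded_eq_cocompact.symm, ← comap_norm_atTop, eventually_comap] at h1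
    obtain ⟨R, hR⟩ := eventually_atTop.1 h1
    exact ⟨max R 0, le_max_right _ _, fun x hx =>
      (hR |x| ((le_max_left _ _).trans hx.le) x rfl).le⟩
  set D := Real.exp (δ * R) * C ^ 2 with hD
  set A := 2 / c * (M * D) + Real.exp (δ * R) * C with hA
  have hD0 : 0 ≤ D := by positivity
  -- Capping the weight at `n` makes the supremum `N` finite in advance, so that it can be absorbed;
  -- the resulting bound `2 * A` does not involve `n`.
  have key : ∀ n : ℝ, 1 ≤ n → ∀ x, min (Real.exp (δ * |x|)) n * |φ x| ≤ 2 * A := by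
    intro n hn
    set w : ℝ → ℝ := fun x => min (Real.exp (δ * |x|)) n with hw
    have hw0 : ∀ x, 0 ≤ w x := fun x => by positivity
    have hwle : ∀ x, w x ≤ Real.exp (δ * |x|) := fun x => min_le_left _ _
    have hwn : ∀ x, w x ≤ n := fun x => min_le_right _ _
    have hws : ∀ x y, w x ≤ Real.exp (δ * |y|) * w (x - y) := by
      intro x y
      have e1 : 1 ≤ Real.exp (δ * |y|) := Real.one_le_exp (by positivity)
      simp only [hw]
      rw [mul_min_of_nonneg _ _ (Real.exp_pos _).le, ← Real.exp_add, ← mul_add]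
      refine min_le_min ?_ (by nlinarith)
      gcongr
      calc |x| = |y + (x - y)| := by ring_nf
        _ ≤ _ := abs_add_le _ _
    have hbdd : BddAbove (range fun x => w x * |φ x|) := by
      refine ⟨n * C, ?_⟩
      rintro _ ⟨x, rfl⟩
      exact mul_le_mul (hwn x) (hC x) (abs_nonneg _) (by linarith)
    set N := ⨆ x, w x * |φ x| with hN
    have hle : ∀ x, w x * |φ x| ≤ N := fun x => le_ciSup hbdd x
    have hN0 : 0 ≤ N := (mul_nonneg (hw0 0) (abs_nonneg _)).trans (hle 0)
    -- Inside radius `R` the crude bound `D` suffices; outside, one factor of `φ²` is at most `ε`.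
    have hsq : ∀ z, w z * φ z ^ 2 ≤ D + ε * N := by
      intro z
      rcases le_or_gt |z| R with hz | hz
      · have : w z * φ z ^ 2 ≤ D := by
          rw [hD, ← sq_abs (φ z)]
          refine mul_le_mul ((hwle z).trans (by gcongr)) ?_ (by positivity) (by positivity)
          exact pow_le_pow_left₀ (abs_nonneg _) (hC z) 2
        have := mul_nonneg hε0.le hN0
        linarith
      · have h1 := (hR z hz).trans (min_le_left _ _)
        have : w z * φ z ^ 2 = |φ z| * (w z * |φ z|) := by rw [← sq_abs (φ z)]; ring
        rw [this]
        have := mul_le_mul h1 (hle z) (mul_nonneg (hw0 z) (abs_nonneg _)) hε0.le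
        linarith
    have hconv : ∀ x, w x * |conv h (fun y => φ y ^ 2) x| ≤ M * (D + ε * N) := by
      intro x
      have : w x * |conv h (fun y => φ y ^ 2) x| = |∫ y, w x * (h y * φ (x - y) ^ 2)| := by
        rw [integral_const_mul, abs_mul, abs_of_nonneg (hw0 x), conv_apply]
      rw [this, hM, ← integral_mul_const, ← Real.norm_eq_abs]
      refine norm_integral_le_of_norm_le (hh.norm.mul_const _) (ae_of_all _ fun y => ?_)
      rw [norm_mul, norm_mul, norm_mul, Real.norm_eq_abs (Real.exp _), Real.abs_exp,
        Real.norm_of_nonneg (hw0 x), Real.norm_of_nonneg (sq_nonneg (φ (x - y)))]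
      calc w x * (‖h y‖ * φ (x - y) ^ 2)
          ≤ (Real.exp (δ * |y|) * w (x - y)) * (‖h y‖ * φ (x - y) ^ 2) := by
            gcongr; exact hws x y
        _ = Real.exp (δ * |y|) * ‖h y‖ * (w (x - y) * φ (x - y) ^ 2) := by ring
        _ ≤ _ := by gcongr; exact hsq _
    have hstep : ∀ x, w x * |φ x| ≤ A + N / 2 := by
      intro x
      rcases le_or_gt |x| R with hx | hx
      · have h1 : w x * |φ x| ≤ Real.exp (δ * R) * C :=
          mul_le_mul ((hwle x).trans (by gcongr)) (hC x) (abs_nonneg _) (Real.exp_pos _).le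
        have h2 : 0 ≤ 2 / c * (M * D) := by positivity
        linarith
      · have h1 := (hR x hx).trans (min_le_right _ _)
        have h2 : c / 2 ≤ |c - φ x| := by
          have := le_abs_self (φ x)
          exact le_trans (by linarith) (le_abs_self _)
        have h3 : c / 2 * (w x * |φ x|) ≤ M * (D + ε * N) := by
          refine le_trans ?_ (hconv x)
          rw [← heq x, abs_mul]
          have := mul_le_mul_of_nonneg_left h2 (mul_nonneg (hw0 x) (abs_nonneg (φ x)))
          linarith
        have h4 : w x * |φ x| ≤ 2 / c * (M * (D + ε * N)) := by
          have := mul_le_mul_of_nonneg_left h3 (show 0 ≤ 2 / c by positivity)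
          rwa [← mul_assoc, show 2 / c * (c / 2) = 1 by field_simp, one_mul] at this
        have h5 : 2 / c * (M * (D + ε * N)) = 2 / c * (M * D) + 2 / c * (M * ε) * N := by ring
        have h6 := mul_le_mul_of_nonneg_right hMε hN0
        have h7 : 0 ≤ Real.exp (δ * R) * C := by positivity
        linarith
    have hNle : N ≤ A + N / 2 := ciSup_le hstep
    intro x
    linarith [hle x]
  refine ⟨2 * A, fun x => ?_⟩
  -- The cap is chosen at the point itself, where it has no effect.
  have := key (Real.exp (δ * |x|)) (Real.one_le_exp (by positivity)) x
  rwa [min_self] at this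

theorem memLp_exp_mul_of_exp_mul_abs_le {δ ν B : ℝ} (hν : ν < δ) {φ : ℝ → ℝ}
    (hφ : Continuous φ) (hB : ∀ x, Real.exp (δ * |x|) * |φ x| ≤ B) :
    MemLp (fun x : ℝ => Real.exp (ν * |x|) * φ x) 1 volume ∧
      MemLp (fun x : ℝ => Real.exp (ν * |x|) * φ x) ⊤ volume := by
  have hm : AEStronglyMeasurable (fun x : ℝ => Real.exp (ν * |x|) * φ x) volume :=
    Continuous.aestronglyMeasurable (by fun_prop)
  have hb : ∀ x, ‖Real.exp (ν * |x|) * φ x‖ ≤ B * Real.exp (-(δ - ν) * |x|) := by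
    intro x
    rw [norm_mul, Real.norm_eq_abs, Real.norm_eq_abs, Real.abs_exp]
    have : Real.exp (ν * |x|) = Real.exp (δ * |x|) * Real.exp (-(δ - ν) * |x|) := by
      rw [← Real.exp_add]; ring_nf
    rw [this, mul_right_comm]
    gcongr
    exact hB x
  have hB0 : 0 ≤ B := le_trans (by positivity) (hB 0)
  constructor
  · rw [memLp_one_iff_integrable]
    exact ((integrable_exp_neg_mul_abs (sub_pos.2 hν)).const_mul B).mono' hm (ae_of_all _ hb)
  · refine memLp_top_of_bound hm B (ae_of_all _ fun x => (hb x).trans ?_)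
    refine mul_le_of_le_one_right hB0 (Real.exp_le_one_iff.2 ?_)
    exact mul_nonpos_of_nonpos_of_nonneg (by linarith) (abs_nonneg x)

/-! ### Contour shifts and exponential decay -/

theorem integrable_one_add_abs_rpow {r : ℝ} (hr : 1 < r) :
    Integrable fun x : ℝ => (1 + |x|) ^ (-r) := by
  simpa using integrable_one_add_norm (E := ℝ) (μ := volume) (r := r) (by simpa using hr)

/-- Shifting the contour of integration inside a strip of holomorphy. -/
theorem integral_add_mul_I_eq {f : ℂ → ℂ} {a t C r : ℝ} (ht : |t| < a) (hr : 1 < r)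
    (hf : DifferentiableOn ℂ f {z | |z.im| < a})
    (hb : ∀ z : ℂ, |z.im| ≤ |t| → ‖f z‖ ≤ C * (1 + |z.re|) ^ (-r)) :
    ∫ x : ℝ, f (x + t * Complex.I) = ∫ x : ℝ, f x := by
  have hline : ∀ u : ℝ, |u| ≤ |t| → Integrable fun x : ℝ => f (x + u * Complex.I) := by
    intro u hu
    refine ((integrable_one_add_abs_rpow hr).const_mul C).mono' ?_ (ae_of_all _ fun x => ?_)
    · refine Continuous.aestronglyMeasurable ?_
      refine hf.continuousOn.comp_continuous (by fun_prop) fun x => ?_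
      simpa using hu.trans_lt ht
    · simpa using hb (x + u * Complex.I) (by simpa using hu)
  have h0 : Integrable fun x : ℝ => f x := by simpa using hline 0 (by simp)
  have hlim1 := intervalIntegral_tendsto_integral h0 tendsto_neg_atTop_atBot tendsto_id
  have hlim2 := intervalIntegral_tendsto_integral (hline t le_rfl) tendsto_neg_atTop_atBot tendsto_id
  have hdecay : Tendsto (fun R : ℝ => C * (1 + |R|) ^ (-r) * |t - 0|) atTop (𝓝 0) := by
    have h1 : Tendsto (fun R : ℝ => (1 + |R|) ^ (-r)) atTop (𝓝 0) :=
      (tendsto_rpow_neg_atTop (by linarith)).comp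
        (tendsto_atTop_add_const_left _ _ tendsto_abs_atTop_atTop)
    simpa using (h1.const_mul C).mul_const |t - 0|
  -- The vertical sides have fixed length `|t|`, while the integrand on them is `O(R^{-r})`.
  have hvert : ∀ σ : ℝ, |σ| = 1 → Tendsto (fun R : ℝ => ∫ y : ℝ in (0 : ℝ)..t,
      f ((σ * R : ℝ) + y * Complex.I)) atTop (𝓝 0) := by
    intro σ hσ
    refine squeeze_zero_norm (fun R => ?_) hdecay
    refine intervalIntegral.norm_integral_le_of_norm_le_const fun y hy => ?_
    have hy' : |y| ≤ |t| := by
      have := abs_sub_left_of_mem_uIcc (uIoc_subset_uIcc hy)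
      simpa using this
    have := hb ((σ * R : ℝ) + y * Complex.I) (by simpa using hy')
    simpa [abs_mul, hσ] using this
  have hrect : ∀ R : ℝ, ((∫ x : ℝ in -R..R, f x) - (∫ x : ℝ in -R..R, f (x + t * Complex.I))) +
      (Complex.I * (∫ y : ℝ in (0 : ℝ)..t, f ((1 * R : ℝ) + y * Complex.I)) -
      Complex.I * ∫ y : ℝ in (0 : ℝ)..t, f ((-1 * R : ℝ) + y * Complex.I)) = 0 := by
    intro R
    have := Complex.integral_boundary_rect_eq_zero_of_differentiableOn f (-R : ℂ)
      (R + t * Complex.I) (hf.mono ?_)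
    · simpa [add_sub_assoc] using this
    · intro z hz
      have h2 : z.im ∈ uIcc 0 t := by simpa using (Complex.mem_reProdIm.1 hz).2
      have := abs_sub_left_of_mem_uIcc h2
      simp only [sub_zero] at this
      exact this.trans_lt ht
  have hlim := (hlim1.sub hlim2).add
    (((hvert 1 (by simp)).const_mul Complex.I).sub ((hvert (-1) (by simp)).const_mul Complex.I))
  have hz : Tendsto (fun _ : ℝ => (0 : ℂ)) atTop (𝓝 ((∫ x : ℝ, f x) -
      (∫ x : ℝ, f (x + t * Complex.I)) + (Complex.I * 0 - Complex.I * 0))) := by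
    refine hlim.congr fun R => ?_
    exact hrect R
  have := tendsto_nhds_unique hz tendsto_const_nhds
  simp only [mul_zero, sub_zero, add_zero] at this
  exact (sub_eq_zero.1 this).symm

/-- Compactness controls the part `|Re z| ≤ 1` of a closed smaller strip; beyond it `1 + |Re z| ≤ 2
|Re z|`, which accounts for the factor `2 ^ r`. -/
theorem exists_norm_le_one_add_rpow {S : ℂ → ℂ} {a δ C r : ℝ} (hδ : δ < a) (hr : 0 ≤ r)
    (hd : ContinuousOn S {z | |z.im| < a})
    (hb : ∀ z : ℂ, |z.im| < a → 1 ≤ |z.re| → ‖S z‖ ≤ C * |z.re| ^ (-r)) :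
    ∃ B, 0 ≤ B ∧ ∀ z : ℂ, |z.im| ≤ δ → ‖S z‖ ≤ B * (1 + |z.re|) ^ (-r) := by
  have hcomp : IsCompact (Icc (-1 : ℝ) 1 ×ℂ Icc (-δ) δ) := isCompact_Icc.reProdIm isCompact_Icc
  obtain ⟨B, hB⟩ := hcomp.exists_bound_of_continuousOn (hd.mono fun z hz =>
    (abs_le.2 (Complex.mem_reProdIm.1 hz).2).trans_lt hδ)
  refine ⟨max (max B C) 0 * 2 ^ r, by positivity, fun z hz => ?_⟩
  have h2 : (2 : ℝ) ^ r * (1 + |z.re|) ^ (-r) = ((1 + |z.re|) / 2) ^ (-r) := by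
    rw [Real.div_rpow (by positivity) (by norm_num), Real.rpow_neg (by norm_num : (0 : ℝ) ≤ 2)]
    field_simp
  rw [mul_assoc, h2]
  rcases le_or_gt |z.re| 1 with h1 | h1
  · calc ‖S z‖ ≤ B := hB z (Complex.mem_reProdIm.2 ⟨abs_le.1 h1, abs_le.1 hz⟩)
      _ ≤ max (max B C) 0 * 1 := by rw [mul_one]; exact (le_max_left _ _).trans (le_max_left _ _)
      _ ≤ _ := by
        gcongr
        exact Real.one_le_rpow_of_pos_of_le_one_of_nonpos (by positivity) (by linarith)
          (by linarith)
  · calc ‖S z‖ ≤ C * |z.re| ^ (-r) := hb z (hz.trans_lt hδ) h1.le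
      _ ≤ max (max B C) 0 * |z.re| ^ (-r) := by
        gcongr; exact (le_max_right _ _).trans (le_max_left _ _)
      _ ≤ _ := by
        refine mul_le_mul_of_nonneg_left ?_ (le_max_right _ _)
        exact Real.rpow_le_rpow_of_nonpos (show 0 < (1 + |z.re|) / 2 by positivity)
          (by linarith) (by linarith)

/-- The inverse Fourier transform of a function that is holomorphic and integrably decaying in a
strip decays exponentially. -/
theorem norm_fourierInv_le {S : ℂ → ℂ} {a δ C r : ℝ} (hδ0 : 0 ≤ δ) (hδ : δ < a) (hr : 1 < r)
    (hd : DifferentiableOn ℂ S {z | |z.im| < a})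
    (hb : ∀ z : ℂ, |z.im| ≤ δ → ‖S z‖ ≤ C * (1 + |z.re|) ^ (-r)) (x : ℝ) :
    ‖FourierTransformInv.fourierInv (fun ξ : ℝ => S ξ) x‖ ≤
      (∫ y : ℝ, C * (1 + |y|) ^ (-r)) * Real.exp (-(2 * Real.pi * δ) * |x|) := by
  -- The shift goes to the side given by the sign of `x`, where the exponential factor gains
  -- `e^{-2πδ|x|}`.
  obtain ⟨t, ht, htx⟩ : ∃ t : ℝ, |t| = δ ∧ t * x = δ * |x| := by
    rcases le_total 0 x with hx | hx
    · exact ⟨δ, abs_of_nonneg hδ0, by rw [abs_of_nonneg hx]⟩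
    · exact ⟨-δ, by rw [abs_neg, abs_of_nonneg hδ0], by rw [abs_of_nonpos hx]; ring⟩
  set f : ℂ → ℂ := fun z => Complex.exp (2 * Real.pi * Complex.I * x * z) * S z with hf
  have hnorm : ∀ z : ℂ, ‖f z‖ = Real.exp (-(2 * Real.pi * (z.im * x))) * ‖S z‖ := by
    intro z
    rw [hf]
    simp only [norm_mul, Complex.norm_exp]
    congr 2
    simp
    ring
  have hfd : DifferentiableOn ℂ f {z | |z.im| < a} :=
    (Differentiable.differentiableOn (by fun_prop)).mul hd
  have hshift : ∫ y : ℝ, f (y + t * Complex.I) = ∫ y : ℝ, f y := by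
    refine integral_add_mul_I_eq (C := Real.exp (2 * Real.pi * (δ * |x|)) * C) (ht ▸ hδ) hr hfd
      fun z hz => ?_
    rw [hnorm, mul_assoc (Real.exp _)]
    rw [ht] at hz
    refine mul_le_mul (Real.exp_le_exp.2 ?_) (hb z hz) (norm_nonneg _) (Real.exp_pos _).le
    have h1 : |z.im * x| ≤ δ * |x| := by rw [abs_mul]; gcongr
    have h2 := (abs_le.1 h1).1
    have := Real.pi_pos
    nlinarith
  have hinv : FourierTransformInv.fourierInv (fun ξ : ℝ => S ξ) x = ∫ y : ℝ, f y := by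
    rw [Real.fourierInv_eq']
    congr 1
    ext y
    simp only [hf, smul_eq_mul]
    congr 2
    simp
    ring
  rw [hinv, ← hshift, ← integral_mul_const]
  refine norm_integral_le_of_norm_le
    (((integrable_one_add_abs_rpow hr).const_mul C).mul_const _) (ae_of_all _ fun y => ?_)
  rw [hnorm, mul_comm]
  have h1 := hb (y + t * Complex.I) (by simp [ht])
  simp only [Complex.add_re, Complex.ofReal_re, Complex.mul_re, Complex.I_re, mul_zero,
    Complex.ofReal_im, Complex.I_im, mul_one, sub_self, add_zero, Complex.add_im, Complex.mul_im,
    zero_add] at h1 ⊢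
  rw [htx, show -(2 * Real.pi * (δ * |x|)) = -(2 * Real.pi * δ) * |x| by ring]
  gcongr

/-- Real kernels are obtained by taking real parts; for a real even transform this formula shows
that nothing changes. -/
theorem fourier_ofReal_re {b : ℝ → ℂ} (hb : Integrable b) (ξ : ℝ) :
    fourier (fun x => ((b x).re : ℂ)) ξ =
      (fourier b ξ + (starRingEnd ℂ) (fourier b (-ξ))) / 2 := by
  have hconj : (starRingEnd ℂ) (fourier b (-ξ)) =
      ∫ x : ℝ, Complex.exp (-(Complex.I * x * ξ)) * (starRingEnd ℂ) (b x) := by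
    rw [fourier_eq_integral, ← integral_conj]
    congr 1
    ext x
    rw [map_mul, ← Complex.exp_conj]
    simp
  have hi : ∀ g : ℝ → ℂ, Integrable g →
      Integrable fun x : ℝ => Complex.exp (-(Complex.I * x * ξ)) * g x := by
    intro g hg
    refine hg.bdd_mul (c := 1)
      (Continuous.aestronglyMeasurable (by fun_prop)) (ae_of_all _ fun x => ?_)
    rw [Complex.norm_exp]
    simp
  rw [hconj, fourier_eq_integral, fourier_eq_integral, ← integral_add (hi _ hb), ← integral_div]
  · congr 1
    ext x
    rw [Complex.re_eq_add_conj]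
    ring
  · exact hi _ ((Complex.conjLIE.toContinuousLinearEquiv.toContinuousLinearMap).integrable_comp hb)

/-- A symbol that is real and even on the line, and holomorphic in a strip with decay
`O(|Re z|^{-3/2})`, is the Fourier transform of an exponentially decaying kernel. -/
theorem exists_isExpKernel {S : ℂ → ℂ} {a C : ℝ} (ha : 0 < a)
    (hd : DifferentiableOn ℂ S {z | |z.im| < a})
    (hb : ∀ z : ℂ, |z.im| < a → 1 ≤ |z.re| → ‖S z‖ ≤ C * |z.re| ^ (-(3 / 2) : ℝ))
    {s : ℝ → ℝ} (hs : ∀ ξ : ℝ, S ξ = s ξ) (heven : ∀ ξ, s (-ξ) = s ξ) :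
    ∃ δ h, IsExpKernel δ h s := by
  have hpi := Real.pi_pos
  obtain ⟨B₀, hB₀, hbB₀⟩ := exists_norm_le_one_add_rpow (half_lt_self ha) (by norm_num)
    hd.continuousOn hb
  -- Rescaling by `2π` passes from the angular frequency to the normalization of Mathlib.
  set T : ℂ → ℂ := fun z => S ((2 * Real.pi : ℝ) * z) with hT
  have him : ∀ z : ℂ, |(((2 * Real.pi : ℝ) : ℂ) * z).im| = 2 * Real.pi * |z.im| := by
    intro z
    rw [Complex.im_ofReal_mul, abs_mul, abs_of_pos (by positivity)]
  have hre : ∀ z : ℂ, |(((2 * Real.pi : ℝ) : ℂ) * z).re| = 2 * Real.pi * |z.re| := by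
    intro z
    rw [Complex.re_ofReal_mul, abs_mul, abs_of_pos (by positivity)]
  have hTd : DifferentiableOn ℂ T {z | |z.im| < a / (2 * Real.pi)} := by
    refine hd.comp (Differentiable.differentiableOn (by fun_prop)) fun z hz => ?_
    rw [mem_ofPred_eq, lt_div_iff₀' (by positivity)] at hz
    rw [mem_ofPred_eq, him]
    exact hz
  have hTb : ∀ z : ℂ, |z.im| ≤ a / 2 / (2 * Real.pi) →
      ‖T z‖ ≤ B₀ * (1 + |z.re|) ^ (-(3 / 2) : ℝ) := by
    intro z hz
    rw [le_div_iff₀' (by positivity), ← him] at hz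
    refine (hbB₀ _ hz).trans ?_
    rw [hre]
    gcongr ?_ * ?_
    refine Real.rpow_le_rpow_of_nonpos (by positivity) ?_ (by norm_num)
    have := abs_nonneg z.re
    nlinarith [Real.two_le_pi]
  set δ := a / 2 with hδ
  have hδ0 : 0 < δ := by positivity
  set b : ℝ → ℂ := FourierTransformInv.fourierInv (fun ξ : ℝ => T ξ) with hbdef
  set B := ∫ y : ℝ, B₀ * (1 + |y|) ^ (-(3 / 2) : ℝ) with hB
  have hbb : ∀ x, ‖b x‖ ≤ B * Real.exp (-δ * |x|) := by
    intro x
    have := norm_fourierInv_le (by positivity) (by gcongr; linarith) (by norm_num) hTd hTb x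
    rwa [show 2 * Real.pi * (δ / (2 * Real.pi)) = δ by field_simp] at this
  have hB0 : 0 ≤ B := by simpa using (norm_nonneg _).trans (hbb 0)
  have hTc : Continuous fun ξ : ℝ => T ξ :=
    hTd.continuousOn.comp_continuous (by fun_prop) fun x => by
      simp only [mem_ofPred_eq, Complex.ofReal_im, abs_zero]; positivity
  have hTi : Integrable fun ξ : ℝ => T ξ := by
    refine ((integrable_one_add_abs_rpow (r := 3 / 2) (by norm_num)).const_mul B₀).mono'
      hTc.aestronglyMeasurable (ae_of_all _ fun x => ?_)
    simpa using hTb x (by simp; positivity)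
  have hbc : Continuous b := by
    have := VectorFourier.fourierIntegral_continuous Real.continuous_fourierChar
      (L := -innerₗ ℝ) (by simpa using! continuous_inner.neg) hTi
    exact this
  have hbi : Integrable b :=
    ((integrable_exp_neg_mul_abs hδ0).const_mul B).mono' hbc.aestronglyMeasurable
      (ae_of_all _ hbb)
  have hFi : Integrable (FourierTransform.fourier (fun ξ : ℝ => T ξ)) := by
    have : FourierTransform.fourier (fun ξ : ℝ => T ξ) = fun x => b (-x) := by
      ext x
      rw [hbdef, Real.fourierInv_eq_fourier_neg, neg_neg]
    rw [this]
    exact hbi.comp_neg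
  have hF : ∀ ξ, fourier b ξ = s ξ := by
    intro ξ
    rw [fourier, hbdef, hTc.fourier_fourierInv_eq hTi hFi, ← hs, hT]
    push_cast
    field_simp
  -- The half of the rate that is given up supplies integrability and absorbs the factor `|x|`.
  refine ⟨δ / 2, fun x => (b x).re, by positivity, ?_, ⟨B * (2 / δ), fun x => ?_⟩, fun ξ => ?_⟩
  · refine ((integrable_exp_neg_mul_abs (half_pos hδ0)).const_mul B).mono'
      (Continuous.aestronglyMeasurable (by fun_prop)) (ae_of_all _ fun x => ?_)
    rw [norm_mul, Real.norm_eq_abs, Real.abs_exp, Real.norm_eq_abs]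
    calc Real.exp (δ / 2 * |x|) * |(b x).re|
        ≤ Real.exp (δ / 2 * |x|) * (B * Real.exp (-δ * |x|)) := by
          gcongr; exact (Complex.abs_re_le_norm _).trans (hbb x)
      _ = B * Real.exp (-(δ / 2) * |x|) := by
          rw [mul_left_comm, ← Real.exp_add]; ring_nf
  · rw [abs_mul, abs_mul, Real.abs_exp]
    have h1 : δ / 2 * |x| ≤ Real.exp (δ / 2 * |x|) := by
      linarith [Real.add_one_le_exp (δ / 2 * |x|)]
    calc Real.exp (δ / 2 * |x|) * (|x| * |(b x).re|)
        ≤ Real.exp (δ / 2 * |x|) * (|x| * (B * Real.exp (-δ * |x|))) := by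
          gcongr; exact (Complex.abs_re_le_norm _).trans (hbb x)
      _ = B * (2 / δ) * (δ / 2 * |x|) * (Real.exp (δ / 2 * |x|) * Real.exp (-δ * |x|)) := by
          field_simp
      _ ≤ B * (2 / δ) * Real.exp (δ / 2 * |x|) *
            (Real.exp (δ / 2 * |x|) * Real.exp (-δ * |x|)) := by gcongr
      _ = B * (2 / δ) := by
          rw [mul_assoc, ← Real.exp_add, ← Real.exp_add,
            show δ / 2 * |x| + (δ / 2 * |x| + -δ * |x|) = 0 by ring, Real.exp_zero, mul_one]
  · rw [fourier_ofReal_re hbi, hF, hF, heven, Complex.conj_ofReal]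
    ring

/-! ### Complex square roots -/

theorem hasDerivAt_cpow_half {W : ℂ → ℂ} {W' z : ℂ} (hW : HasDerivAt W W' z)
    (hz : W z ∈ Complex.slitPlane) :
    HasDerivAt (fun w => W w ^ (1 / 2 : ℂ)) (W z ^ (1 / 2 : ℂ) * (W' / (2 * W z))) z := by
  have h0 : W z ≠ 0 := Complex.slitPlane_ne_zero hz
  convert hW.cpow_const (c := 1 / 2) hz using 1
  rw [Complex.cpow_sub _ _ h0, Complex.cpow_one]
  field_simp

theorem norm_cpow_half (w : ℂ) : ‖w ^ (1 / 2 : ℂ)‖ = ‖w‖ ^ (1 / 2 : ℝ) := by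
  have := Complex.norm_cpow_real w (1 / 2)
  push_cast at this
  exact this

theorem cpow_half_sq (w : ℂ) : (w ^ (1 / 2 : ℂ)) ^ 2 = w := by
  rw [← Complex.cpow_nat_mul]
  norm_num

theorem re_cpow_half_nonneg (w : ℂ) : 0 ≤ (w ^ (1 / 2 : ℂ)).re := by
  rcases eq_or_ne w 0 with rfl | hw
  · simp
  rw [Complex.cpow_def_of_ne_zero hw, Complex.exp_re]
  refine mul_nonneg (Real.exp_pos _).le (Real.cos_nonneg_of_neg_pi_div_two_le_of_le ?_ ?_)
  all_goals
    have h1 := Complex.neg_pi_lt_log_im w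
    have h2 := Complex.log_im_le_pi w
    simp
    linarith

theorem norm_cpow_half_le {w : ℂ} {x A : ℝ} (hx : 0 < x) (hA : ‖w‖ ≤ A / x) :
    ‖w ^ (1 / 2 : ℂ)‖ ≤ √A * x ^ (-(1 / 2) : ℝ) := by
  have hA0 : 0 ≤ A := by
    have := (norm_nonneg w).trans hA
    rwa [le_div_iff₀ hx, zero_mul] at this
  rw [norm_cpow_half, Real.sqrt_eq_rpow, Real.rpow_neg hx.le, ← div_eq_mul_inv,
    ← Real.div_rpow hA0 hx.le]
  gcongr

/-- The derivative of a square root is the root times half the logarithmic derivative: orders `-1/2`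
and `-1` combine to the required `-3/2`. -/
theorem norm_cpow_half_mul_le {w w' : ℂ} {x A D : ℝ} (hx : 0 < x) (hA : ‖w‖ ≤ A / x)
    (hD : ‖w' / w‖ ≤ D / x) :
    ‖w ^ (1 / 2 : ℂ) * (w' / (2 * w))‖ ≤ √A * D / 2 * x ^ (-(3 / 2) : ℝ) := by
  have h1 : w' / (2 * w) = w' / w / 2 := by rw [mul_comm, div_div]
  have h2 : x ^ (-(3 / 2) : ℝ) = x ^ (-(1 / 2) : ℝ) / x := by
    rw [show (-(3 / 2) : ℝ) = -(1 / 2) - 1 by norm_num, Real.rpow_sub hx, Real.rpow_one]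
  rw [norm_mul, h1, norm_div, h2]
  calc ‖w ^ (1 / 2 : ℂ)‖ * (‖w' / w‖ / ‖(2 : ℂ)‖)
      ≤ (√A * x ^ (-(1 / 2) : ℝ)) * (D / x / ‖(2 : ℂ)‖) := by
        gcongr; exact norm_cpow_half_le hx hA
    _ = _ := by rw [Complex.norm_ofNat]; ring

/-! ### The model kernel with singularity `|x|^{-1/2}` -/

/-- The Laplace transform of `x ↦ x^{-1/2}`. -/
theorem integral_rpow_mul_cexp_Ioi {b : ℂ} (hb : 0 < b.re) :
    ∫ x : ℝ in Ioi 0, ((x ^ (-(1 / 2) : ℝ) : ℝ) : ℂ) * Complex.exp (-b * x) =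
      (Real.pi / b) ^ (1 / 2 : ℂ) := by
  -- Replacing `x` by `x²` turns the integral into a half-line Gaussian.
  rw [← integral_comp_rpow_Ioi_of_pos (p := 2) (by norm_num)]
  have h := integral_gaussian_complex_Ioi hb
  have : ∀ x ∈ Ioi (0 : ℝ), ((2 : ℝ) * x ^ ((2 : ℝ) - 1)) •
      ((((x ^ (2 : ℝ)) ^ (-(1 / 2) : ℝ) : ℝ) : ℂ) * Complex.exp (-b * ((x ^ (2 : ℝ) : ℝ) : ℂ))) =
      2 * Complex.exp (-b * (x : ℂ) ^ 2) := by
    intro x hx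
    have hx0 : (0 : ℝ) < x := hx
    rw [← Real.rpow_mul hx0.le]
    norm_num
    rw [Real.rpow_neg_one, Complex.ofReal_inv]
    have : (x : ℂ) ≠ 0 := by exact_mod_cast hx0.ne'
    field_simp
  rw [setIntegral_congr_fun measurableSet_Ioi this, integral_const_mul, h]
  ring

/-- The kernel `|x|^{-1/2} e^{-|x|}`, which models the singularity of the Whitham kernel. -/
def modelKernel (x : ℝ) : ℝ := |x| ^ (-(1 / 2) : ℝ) * Real.exp (-|x|)

/-- The holomorphic extension to `|Im z| < 1` of the Fourier transform of `modelKernel`. -/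
def modelSymbol (z : ℂ) : ℂ :=
  (Real.pi / (1 + Complex.I * z)) ^ (1 / 2 : ℂ) + (Real.pi / (1 - Complex.I * z)) ^ (1 / 2 : ℂ)

theorem integrable_exp_mul_modelKernel :
    Integrable fun x => Real.exp (1 / 2 * |x|) * modelKernel x := by
  have h := integrableOn_rpow_mul_exp_neg_mul_rpow (p := 1) (s := -(1 / 2)) (b := 1 / 2)
    (by norm_num) one_pos (by norm_num)
  have h2 := integrable_comp_abs h
  refine h2.congr (ae_of_all _ fun x => ?_)
  simp only [modelKernel, Real.rpow_one]
  rw [mul_left_comm, ← Real.exp_add]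
  ring_nf

theorem integrable_modelKernel : Integrable modelKernel := by
  simpa using integrable_exp_mul_mono (δ' := 0) (by norm_num) integrable_exp_mul_modelKernel

theorem fourier_modelKernel (ξ : ℝ) :
    fourier (fun x => (modelKernel x : ℂ)) ξ = modelSymbol ξ := by
  have hi : Integrable fun x : ℝ => Complex.exp (-(Complex.I * x * ξ)) * (modelKernel x : ℂ) := by
    refine (integrable_modelKernel.ofReal (𝕜 := ℂ)).bdd_mul (c := 1)
      (Continuous.aestronglyMeasurable (by fun_prop)) (ae_of_all _ fun x => ?_)
    rw [Complex.norm_exp]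
    simp
  rw [fourier_eq_integral, ← integral_add_compl measurableSet_Ioi hi (s := Ioi 0), compl_Ioi,
    modelSymbol]
  congr 1
  · rw [← integral_rpow_mul_cexp_Ioi (by simp)]
    refine setIntegral_congr_fun measurableSet_Ioi fun x hx => ?_
    simp only [modelKernel, abs_of_pos (mem_Ioi.1 hx)]
    push_cast
    rw [mul_left_comm, ← Complex.exp_add]
    ring_nf
  · rw [← integral_rpow_mul_cexp_Ioi (by simp), ← neg_zero, ← integral_comp_neg_Iic, neg_zero]
    refine setIntegral_congr_fun measurableSet_Iic fun x hx => ?_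
    simp only [modelKernel, abs_of_nonpos (mem_Iic.1 hx)]
    push_cast
    rw [mul_left_comm, ← Complex.exp_add]
    ring_nf

theorem arg_pi_div_one_add_I_mul_ne (ξ : ℝ) : (Real.pi / (1 + Complex.I * ξ) : ℂ).arg ≠ Real.pi := by
  refine (Complex.mem_slitPlane_iff_arg.1 (Or.inl ?_)).1
  rw [Complex.div_re]
  simp
  have := Complex.normSq_nonneg (1 + Complex.I * ξ)
  have hne : (1 + Complex.I * ξ) ≠ 0 := by
    intro h; have := congrArg Complex.re h; simp at this
  have := Complex.normSq_pos.2 hne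
  have := Real.pi_pos
  positivity

theorem pi_div_one_sub_I_mul_cpow_half (ξ : ℝ) : (Real.pi / (1 - Complex.I * ξ) : ℂ) ^ (1 / 2 : ℂ) =
    (starRingEnd ℂ) ((Real.pi / (1 + Complex.I * ξ) : ℂ) ^ (1 / 2 : ℂ)) := by
  have h := Complex.conj_cpow _ (1 / 2 : ℂ) (arg_pi_div_one_add_I_mul_ne ξ)
  have h2 : (starRingEnd ℂ) 2 = 2 := Complex.conj_ofNat 2
  simpa [sub_eq_add_neg, h2] using h

/-- The Fourier transform of `modelKernel` as a real function. -/
def modelSymbolReal (ξ : ℝ) : ℝ :=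
  2 * ((Real.pi / (1 + Complex.I * ξ) : ℂ) ^ (1 / 2 : ℂ)).re

theorem modelSymbol_ofReal (ξ : ℝ) : modelSymbol ξ = modelSymbolReal ξ := by
  rw [modelSymbol, pi_div_one_sub_I_mul_cpow_half, Complex.add_conj, modelSymbolReal]

theorem modelSymbolReal_neg (ξ : ℝ) : modelSymbolReal (-ξ) = modelSymbolReal ξ := by
  have : (modelSymbolReal (-ξ) : ℂ) = modelSymbolReal ξ := by
    rw [← modelSymbol_ofReal, ← modelSymbol_ofReal, modelSymbol, modelSymbol, add_comm]
    simp [sub_eq_add_neg]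
  exact_mod_cast this

theorem modelSymbolReal_nonneg (ξ : ℝ) : 0 ≤ modelSymbolReal ξ := by
  exact mul_nonneg (by norm_num) (re_cpow_half_nonneg _)

/-- If `u² = w`, then `2 (Re u)² = Re w + |w|`. The squared form allows comparison with `m² = tanh ξ
/ ξ` without complex roots. -/
theorem modelSymbolReal_sq (ξ : ℝ) :
    modelSymbolReal ξ ^ 2 = 2 * Real.pi * (1 / (1 + ξ ^ 2) + 1 / √(1 + ξ ^ 2)) := by
  set w : ℂ := Real.pi / (1 + Complex.I * ξ) with hw
  set u := w ^ (1 / 2 : ℂ) with hu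
  have h1 : u ^ 2 = w := cpow_half_sq w
  have h2 : u.re ^ 2 - u.im ^ 2 = w.re := by
    rw [← h1, sq u, Complex.mul_re]; ring
  have hn : ‖1 + Complex.I * ξ‖ = √(1 + ξ ^ 2) := by
    rw [Complex.norm_def, Complex.normSq_apply]
    simp [sq]
  have h3 : u.re ^ 2 + u.im ^ 2 = Real.pi / √(1 + ξ ^ 2) := by
    have e1 : u.re ^ 2 + u.im ^ 2 = ‖u‖ ^ 2 := by
      rw [← Complex.normSq_eq_norm_sq, Complex.normSq_apply]; ring
    rw [e1, ← norm_pow, h1, hw, norm_div, hn, Complex.norm_real, Real.norm_of_nonneg Real.pi_pos.le]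
  have h4 : w.re = Real.pi / (1 + ξ ^ 2) := by
    rw [hw, Complex.div_re, Complex.normSq_apply]
    simp [sq]
  have : modelSymbolReal ξ ^ 2 = 2 * ((u.re ^ 2 - u.im ^ 2) + (u.re ^ 2 + u.im ^ 2)) := by
    rw [modelSymbolReal]; ring
  rw [this, h2, h3, h4]
  ring

theorem isExpKernel_modelKernel : IsExpKernel (1 / 2) modelKernel modelSymbolReal where
  pos := by norm_num
  integrable_exp := integrable_exp_mul_modelKernel
  bounded := by
    refine ⟨2, fun x => ?_⟩
    rcases eq_or_ne x 0 with rfl | hx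
    · simp
    have hx0 : 0 < |x| := abs_pos.2 hx
    have h1 : |x| * |x| ^ (-(1 / 2) : ℝ) ≤ 1 + |x| := by
      rw [← Real.rpow_one_add' hx0.le (by norm_num)]
      norm_num
      rw [← Real.sqrt_eq_rpow]
      exact Real.sqrt_le_iff.2 ⟨by positivity, by nlinarith⟩
    have h2 : 1 + |x| ≤ 2 * Real.exp (1 / 2 * |x|) := by
      linarith [Real.add_one_le_exp (1 / 2 * |x|)]
    have h3 : |Real.exp (1 / 2 * |x|) * (x * modelKernel x)| =
        (|x| * |x| ^ (-(1 / 2) : ℝ)) * (Real.exp (1 / 2 * |x|) * Real.exp (-|x|)) := by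
      rw [modelKernel, abs_mul, abs_mul, abs_mul, Real.abs_exp, Real.abs_exp,
        abs_of_nonneg (Real.rpow_nonneg hx0.le _)]
      ring
    rw [h3]
    calc _ ≤ (2 * Real.exp (1 / 2 * |x|)) * (Real.exp (1 / 2 * |x|) * Real.exp (-|x|)) := by
          exact mul_le_mul_of_nonneg_right (h1.trans h2) (by positivity)
      _ = 2 := by
          rw [mul_assoc, ← Real.exp_add, ← Real.exp_add,
            show 1 / 2 * |x| + (1 / 2 * |x| + -|x|) = 0 by ring, Real.exp_zero, mul_one]
  fourier_eq ξ := by rw [fourier_modelKernel, modelSymbol_ofReal]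

theorem re_pos_pi_div {b : ℂ} (hb : 0 < b.re) : 0 < (Real.pi / b : ℂ).re := by
  have h0 : b ≠ 0 := fun h => by simp [h] at hb
  have := Complex.normSq_pos.2 h0
  have := Real.pi_pos
  rw [Complex.div_re]
  simp
  positivity

theorem hasDerivAt_pi_div_cpow_half {ε z : ℂ} (hz : 0 < (1 + ε * z).re) :
    HasDerivAt (fun z => (Real.pi / (1 + ε * z)) ^ (1 / 2 : ℂ))
      ((Real.pi / (1 + ε * z)) ^ (1 / 2 : ℂ) *
        ((-(Real.pi * ε) / (1 + ε * z) ^ 2) / (2 * (Real.pi / (1 + ε * z))))) z := by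
  have h0 : 1 + ε * z ≠ 0 := fun h => by simp [h] at hz
  refine hasDerivAt_cpow_half (W := fun z => Real.pi / (1 + ε * z)) ?_ (Or.inl (re_pos_pi_div hz))
  have h1 : HasDerivAt (fun z => 1 + ε * z) ε z := by
    simpa using ((hasDerivAt_id z).const_mul ε).const_add 1
  have h2 := (hasDerivAt_const z (Real.pi : ℂ)).fun_div h1 h0
  rwa [zero_mul, zero_sub] at h2

theorem norm_deriv_pi_div_cpow_half_le {ε z : ℂ} (hε : ‖ε‖ = 1) (hre : 0 < |z.re|)
    (him : |z.re| ≤ ‖1 + ε * z‖) :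
    ‖(Real.pi / (1 + ε * z)) ^ (1 / 2 : ℂ) *
        ((-(Real.pi * ε) / (1 + ε * z) ^ 2) / (2 * (Real.pi / (1 + ε * z))))‖ ≤
      √Real.pi / 2 * |z.re| ^ (-(3 / 2) : ℝ) := by
  have h0 : 1 + ε * z ≠ 0 := fun h => by simp [h] at him; simp [him] at hre
  have hpi : (Real.pi : ℂ) ≠ 0 := by exact_mod_cast Real.pi_ne_zero
  have := norm_cpow_half_mul_le (w := Real.pi / (1 + ε * z))
    (w' := -(Real.pi * ε) / (1 + ε * z) ^ 2) (A := Real.pi) (D := 1) hre ?_ ?_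
  · simpa using this
  · rw [norm_div, Complex.norm_real, Real.norm_of_nonneg Real.pi_pos.le]
    gcongr
  · have : -(Real.pi * ε) / (1 + ε * z) ^ 2 / (Real.pi / (1 + ε * z)) = -ε / (1 + ε * z) := by
      field_simp
    rw [this, norm_div, norm_neg, hε]
    gcongr

theorem re_one_add_I_mul {z : ℂ} : (1 + Complex.I * z).re = 1 - z.im ∧
    (1 + Complex.I * z).im = z.re ∧ (1 + -Complex.I * z).re = 1 + z.im ∧
    (1 + -Complex.I * z).im = -z.re := by
  simp [sub_eq_add_neg]

theorem exists_hasDerivAt_modelSymbol {z : ℂ} (hz : |z.im| < 1) :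
    ∃ d, HasDerivAt modelSymbol d z ∧
      (0 < |z.re| → ‖d‖ ≤ √Real.pi * |z.re| ^ (-(3 / 2) : ℝ)) := by
  obtain ⟨h1, h2, h3, h4⟩ := re_one_add_I_mul (z := z)
  have hz' := abs_lt.1 hz
  have e1 := hasDerivAt_pi_div_cpow_half (ε := Complex.I) (z := z) (by rw [h1]; linarith)
  have e2 := hasDerivAt_pi_div_cpow_half (ε := -Complex.I) (z := z) (by rw [h3]; linarith)
  have heq : modelSymbol = fun z => (Real.pi / (1 + Complex.I * z)) ^ (1 / 2 : ℂ) +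
      (Real.pi / (1 + -Complex.I * z)) ^ (1 / 2 : ℂ) := by
    ext z; rw [modelSymbol, neg_mul, sub_eq_add_neg]
  refine ⟨_, by rw [heq]; exact e1.add e2, fun hre => ?_⟩
  refine (norm_add_le _ _).trans ?_
  have b1 := norm_deriv_pi_div_cpow_half_le (ε := Complex.I) (z := z) (by simp) hre
    (by rw [← h2]; exact Complex.abs_im_le_norm _)
  have b2 := norm_deriv_pi_div_cpow_half_le (ε := -Complex.I) (z := z) (by simp) hre
    (by rw [← abs_neg, ← h4]; exact Complex.abs_im_le_norm _)
  linarith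

/-! ### The function `tanh z / z` in a strip -/

theorem normSq_sinh (z : ℂ) :
    Complex.normSq (Complex.sinh z) = Real.sinh z.re ^ 2 + Real.sin z.im ^ 2 := by
  have h1 := Real.cosh_sq z.re
  have h2 := Real.sin_sq_add_cos_sq z.im
  conv_lhs => rw [← Complex.re_add_im z]
  rw [Complex.sinh_add, Complex.cosh_mul_I, Complex.sinh_mul_I, Complex.normSq_apply]
  simp only [← Complex.ofReal_sinh, ← Complex.ofReal_cosh, ← Complex.ofReal_sin,
    ← Complex.ofReal_cos, Complex.add_re, Complex.mul_re, Complex.ofReal_re, Complex.ofReal_im,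
    Complex.I_re, Complex.I_im, Complex.add_im, Complex.mul_im]
  ring_nf
  rw [h1]
  linear_combination (Real.sinh z.re ^ 2) * h2

theorem normSq_cosh (z : ℂ) :
    Complex.normSq (Complex.cosh z) = Real.sinh z.re ^ 2 + Real.cos z.im ^ 2 := by
  have h1 := Real.cosh_sq z.re
  have h2 := Real.sin_sq_add_cos_sq z.im
  conv_lhs => rw [← Complex.re_add_im z]
  rw [Complex.cosh_add, Complex.cosh_mul_I, Complex.sinh_mul_I, Complex.normSq_apply]
  simp only [← Complex.ofReal_sinh, ← Complex.ofReal_cosh, ← Complex.ofReal_sin,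
    ← Complex.ofReal_cos, Complex.add_re, Complex.mul_re, Complex.ofReal_re, Complex.ofReal_im,
    Complex.I_re, Complex.I_im, Complex.add_im, Complex.mul_im]
  ring_nf
  rw [h1]
  linear_combination (Real.sinh z.re ^ 2) * h2

/-- This fixes the width `π/4`: there `sin² ≤ 1/2 ≤ cos²`, which keeps `cosh` away from zero and
gives `|sinh| ≤ |cosh|`. -/
theorem half_le_cos_sq {y : ℝ} (hy : |y| < Real.pi / 4) : 1 / 2 ≤ Real.cos y ^ 2 := by
  have h := abs_lt.1 hy
  have : 0 ≤ Real.cos (2 * y) :=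
    Real.cos_nonneg_of_neg_pi_div_two_le_of_le (by linarith) (by linarith)
  rw [Real.cos_two_mul] at this
  linarith

theorem half_le_norm_cosh {z : ℂ} (hz : |z.im| < Real.pi / 4) : 1 / 2 ≤ ‖Complex.cosh z‖ := by
  have h1 := half_le_cos_sq hz
  have h2 := normSq_cosh z
  rw [Complex.normSq_eq_norm_sq] at h2
  nlinarith [sq_nonneg (Real.sinh z.re), norm_nonneg (Complex.cosh z)]

theorem norm_sinh_le_norm_cosh {z : ℂ} (hz : |z.im| < Real.pi / 4) :
    ‖Complex.sinh z‖ ≤ ‖Complex.cosh z‖ := by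
  have h1 := half_le_cos_sq hz
  have h2 := normSq_cosh z
  have h3 := normSq_sinh z
  have h4 := Real.sin_sq_add_cos_sq z.im
  rw [Complex.normSq_eq_norm_sq] at h2 h3
  exact (sq_le_sq₀ (norm_nonneg _) (norm_nonneg _)).1 (by linarith)

theorem abs_re_le_norm_sinh (z : ℂ) : |z.re| ≤ ‖Complex.sinh z‖ := by
  have h3 := normSq_sinh z
  rw [Complex.normSq_eq_norm_sq] at h3
  have h4 : |z.re| ≤ |Real.sinh z.re| := by
    rw [Real.abs_sinh]
    exact Real.self_le_sinh_iff.2 (abs_nonneg _)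
  refine h4.trans (abs_le.2 (abs_le_of_sq_le_sq' ?_ (norm_nonneg _)))
  nlinarith [sq_nonneg (Real.sin z.im)]

/-- The function `tanh z / z`, with the removable singularity at `0` filled in. -/
def tanhc (z : ℂ) : ℂ := dslope Complex.sinh 0 z / Complex.cosh z

theorem tanhc_zero : tanhc 0 = 1 := by
  simp [tanhc]

theorem tanhc_of_ne {z : ℂ} (hz : z ≠ 0) :
    tanhc z = Complex.sinh z / (z * Complex.cosh z) := by
  rw [tanhc, dslope_of_ne _ hz, slope_def_field]
  simp [div_div]

theorem cosh_ne_zero {z : ℂ} (hz : |z.im| < Real.pi / 4) : Complex.cosh z ≠ 0 := by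
  intro h
  have := half_le_norm_cosh hz
  rw [h, norm_zero] at this
  norm_num at this

theorem differentiableOn_tanhc : DifferentiableOn ℂ tanhc {z | |z.im| < Real.pi / 4} := by
  have h : DifferentiableOn ℂ (dslope Complex.sinh 0) univ :=
    (Complex.differentiableOn_dslope univ_mem).2 Complex.differentiable_sinh.differentiableOn
  exact (h.mono (subset_univ _)).div Complex.differentiable_cosh.differentiableOn
    fun z hz => cosh_ne_zero hz

/-- With `z = x + iy`, the real part of `sinh z` times the conjugate of `z cosh z` is `x sinh x cosh
x + y sin y cos y`, a sum of nonnegative terms not both zero. Hence the principal square root is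
holomorphic along `tanhc`. -/
theorem re_tanhc_pos {z : ℂ} (hz : |z.im| < Real.pi / 4) : 0 < (tanhc z).re := by
  rcases eq_or_ne z 0 with rfl | h0
  · simp [tanhc_zero]
  have hc := cosh_ne_zero hz
  have hpos : 0 < Complex.normSq (z * Complex.cosh z) := Complex.normSq_pos.2 (mul_ne_zero h0 hc)
  have h := abs_lt.1 hz
  have hpi := Real.pi_pos
  have hcos : 0 < Real.cos z.im := Real.cos_pos_of_mem_Ioo ⟨by linarith, by linarith⟩
  have h1 : (tanhc z).re * Complex.normSq (z * Complex.cosh z) =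
      z.re * Real.sinh z.re * Real.cosh z.re + z.im * Real.sin z.im * Real.cos z.im := by
    have e : (tanhc z).re * Complex.normSq (z * Complex.cosh z) =
        (Complex.sinh z * (starRingEnd ℂ) (z * Complex.cosh z)).re := by
      rw [tanhc_of_ne h0, ← Complex.re_mul_ofReal, Complex.normSq_eq_conj_mul_self]
      congr 1
      field_simp
    have hcs := Real.sin_sq_add_cos_sq z.im
    have hch := Real.cosh_sq z.re
    have e2 : Complex.sinh z = ⟨Real.sinh z.re * Real.cos z.im, Real.cosh z.re * Real.sin z.im⟩ := by
      conv_lhs => rw [← Complex.re_add_im z]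
      rw [Complex.sinh_add, Complex.cosh_mul_I, Complex.sinh_mul_I]
      apply Complex.ext <;> simp [← Complex.ofReal_sinh, ← Complex.ofReal_cosh,
        ← Complex.ofReal_sin, ← Complex.ofReal_cos]
    have e3 : Complex.cosh z = ⟨Real.cosh z.re * Real.cos z.im, Real.sinh z.re * Real.sin z.im⟩ := by
      conv_lhs => rw [← Complex.re_add_im z]
      rw [Complex.cosh_add, Complex.cosh_mul_I, Complex.sinh_mul_I]
      apply Complex.ext <;> simp [← Complex.ofReal_sinh, ← Complex.ofReal_cosh,
        ← Complex.ofReal_sin, ← Complex.ofReal_cos]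
    rw [e, e2, e3]
    simp only [map_mul, Complex.mul_re, Complex.mul_im, Complex.conj_re, Complex.conj_im]
    linear_combination (z.re * Real.sinh z.re * Real.cosh z.re) * hcs +
      (z.im * Real.sin z.im * Real.cos z.im) * hch
  have h2 : 0 ≤ z.re * Real.sinh z.re := by
    rcases le_total 0 z.re with hx | hx
    · exact mul_nonneg hx (Real.sinh_nonneg_iff.2 hx)
    · exact mul_nonneg_of_nonpos_of_nonpos hx (Real.sinh_nonpos_iff.2 hx)
  have h3 : 0 ≤ z.im * Real.sin z.im := by
    rcases le_total 0 z.im with hx | hx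
    · exact mul_nonneg hx (Real.sin_nonneg_of_nonneg_of_le_pi hx (by linarith))
    · exact mul_nonneg_of_nonpos_of_nonpos hx
        (Real.sin_nonpos_of_nonpos_of_neg_pi_le hx (by linarith))
  have hch := Real.cosh_pos z.re
  have h4 : 0 < z.re * Real.sinh z.re * Real.cosh z.re + z.im * Real.sin z.im * Real.cos z.im := by
    rcases eq_or_ne z.re 0 with hx | hx
    · have hy : z.im ≠ 0 := fun hy => h0 (Complex.ext hx hy)
      have : 0 < z.im * Real.sin z.im := by
        rcases lt_or_gt_of_ne hy with hy | hy
        · exact mul_pos_of_neg_of_neg hy (Real.sin_neg_of_neg_of_neg_pi_lt hy (by linarith))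
        · exact mul_pos hy (Real.sin_pos_of_pos_of_lt_pi hy (by linarith))
      have := mul_pos this hcos
      have := mul_nonneg h2 hch.le
      linarith
    · have : 0 < z.re * Real.sinh z.re := by
        rcases lt_or_gt_of_ne hx with hx | hx
        · exact mul_pos_of_neg_of_neg hx (Real.sinh_neg_iff.2 hx)
        · exact mul_pos hx (Real.sinh_pos_iff.2 hx)
      have := mul_pos this hch
      have := mul_nonneg h3 hcos.le
      linarith
  rw [← h1] at h4
  exact pos_of_mul_pos_left h4 hpos.le

theorem norm_tanhc_le {z : ℂ} (hz : |z.im| < Real.pi / 4) (hre : 0 < |z.re|) :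
    ‖tanhc z‖ ≤ 1 / |z.re| := by
  have h0 : z ≠ 0 := fun h => by simp [h] at hre
  have hc : 0 < ‖Complex.cosh z‖ := norm_pos_iff.2 (cosh_ne_zero hz)
  rw [tanhc_of_ne h0, norm_div, norm_mul, div_le_div_iff₀ (by positivity) hre, one_mul, mul_comm]
  exact mul_le_mul (Complex.abs_re_le_norm z) (norm_sinh_le_norm_cosh hz) (norm_nonneg _)
    (norm_nonneg _)

/-- The logarithmic derivative is `1/(sinh z cosh z) - 1/z`; the two terms contribute `2` and `1` to
the constant. -/
theorem exists_hasDerivAt_tanhc {z : ℂ} (hz : |z.im| < Real.pi / 4) (hre : 0 < |z.re|) :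
    ∃ d, HasDerivAt tanhc d z ∧ ‖d / tanhc z‖ ≤ 3 / |z.re| := by
  have h0 : z ≠ 0 := fun h => by simp [h] at hre
  have hc := cosh_ne_zero hz
  have hs : Complex.sinh z ≠ 0 := fun h => by
    have := abs_re_le_norm_sinh z
    rw [h, norm_zero] at this
    linarith
  have hd := (Complex.hasDerivAt_sinh z).fun_div
    ((hasDerivAt_id' z).fun_mul (Complex.hasDerivAt_cosh z)) (mul_ne_zero h0 hc)
  have heq : tanhc =ᶠ[𝓝 z] fun z => Complex.sinh z / (z * Complex.cosh z) :=
    (eventually_ne_nhds h0).mono fun w hw => tanhc_of_ne hw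
  refine ⟨_, hd.congr_of_eventuallyEq heq, ?_⟩
  have hcs := Complex.cosh_sq_sub_sinh_sq z
  have : (Complex.cosh z * (z * Complex.cosh z) -
      Complex.sinh z * (1 * Complex.cosh z + z * Complex.sinh z)) / (z * Complex.cosh z) ^ 2 /
      tanhc z = 1 / (Complex.sinh z * Complex.cosh z) - 1 / z := by
    rw [tanhc_of_ne h0]
    field_simp
    linear_combination z * hcs
  rw [this]
  have b1 : ‖1 / (Complex.sinh z * Complex.cosh z)‖ ≤ 2 / |z.re| := by
    rw [norm_div, norm_one, norm_mul, div_le_div_iff₀ (by positivity) hre]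
    have := mul_le_mul (abs_re_le_norm_sinh z) (half_le_norm_cosh hz) (by norm_num)
      (norm_nonneg _)
    linarith
  have b2 : ‖1 / z‖ ≤ 1 / |z.re| := by
    rw [norm_div, norm_one]
    gcongr
    exact Complex.abs_re_le_norm z
  calc _ ≤ _ := norm_sub_le _ _
    _ ≤ 2 / |z.re| + 1 / |z.re| := add_le_add b1 b2
    _ = _ := by ring

/-! ### The Whitham symbol on the line and in the strip -/

/-- The holomorphic extension of the Whitham symbol to `|Im z| < π/4`. -/
def symbol (z : ℂ) : ℂ := tanhc z ^ (1 / 2 : ℂ)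

theorem differentiableOn_symbol : DifferentiableOn ℂ symbol {z | |z.im| < Real.pi / 4} :=
  differentiableOn_tanhc.cpow_const fun _ hz => Or.inl (re_tanhc_pos hz)

theorem norm_symbol_le {z : ℂ} (hz : |z.im| < Real.pi / 4) (hre : 0 < |z.re|) :
    ‖symbol z‖ ≤ |z.re| ^ (-(1 / 2) : ℝ) := by
  simpa [symbol] using norm_cpow_half_le hre (norm_tanhc_le hz hre)

theorem norm_deriv_symbol_le {z : ℂ} (hz : |z.im| < Real.pi / 4) (hre : 0 < |z.re|) :
    ‖deriv symbol z‖ ≤ 3 / 2 * |z.re| ^ (-(3 / 2) : ℝ) := by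
  obtain ⟨d, hd, hle⟩ := exists_hasDerivAt_tanhc hz hre
  have := hasDerivAt_cpow_half hd (Or.inl (re_tanhc_pos hz))
  rw [show deriv symbol z = _ from this.deriv]
  simpa using norm_cpow_half_mul_le hre (norm_tanhc_le hz hre) hle

theorem m_sq {ξ : ℝ} (hξ : ξ ≠ 0) : m ξ ^ 2 = Real.tanh ξ / ξ ∧ 0 ≤ Real.tanh ξ / ξ := by
  have h : 0 ≤ Real.tanh ξ / ξ := by
    rcases le_total 0 ξ with h | h
    · exact div_nonneg (by rw [Real.tanh_eq_sinh_div_cosh];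
                           exact div_nonneg (Real.sinh_nonneg_iff.2 h) (Real.cosh_pos _).le) h
    · exact div_nonneg_of_nonpos (by
        rw [Real.tanh_eq_sinh_div_cosh]
        exact div_nonpos_of_nonpos_of_nonneg (Real.sinh_nonpos_iff.2 h) (Real.cosh_pos _).le) h
  rw [m, if_neg hξ, Real.sq_sqrt h]
  exact ⟨rfl, h⟩

theorem m_nonneg (ξ : ℝ) : 0 ≤ m ξ := by
  rw [m]
  split_ifs
  · norm_num
  · exact Real.sqrt_nonneg _

theorem m_neg (ξ : ℝ) : m (-ξ) = m ξ := by
  simp [m, Real.tanh_neg]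

/-- This is `tanh ξ ≤ ξ` for `ξ > 0`, from the monotonicity of `x cosh x - sinh x`, whose derivative
is `x sinh x`. -/
theorem m_le_one (ξ : ℝ) : m ξ ≤ 1 := by
  have hmono : MonotoneOn (fun x => x * Real.cosh x - Real.sinh x) (Ici 0) := by
    have hd : ∀ x, HasDerivAt (fun x => x * Real.cosh x - Real.sinh x) (x * Real.sinh x) x := by
      intro x
      have := ((hasDerivAt_id' x).fun_mul (Real.hasDerivAt_cosh x)).fun_sub
        (Real.hasDerivAt_sinh x)
      rwa [one_mul, add_sub_cancel_left] at this
    refine monotoneOn_of_deriv_nonneg (convex_Ici 0)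
      (fun x _ => (hd x).continuousAt.continuousWithinAt)
      (fun x _ => (hd x).differentiableAt.differentiableWithinAt) fun x hx => ?_
    rw [interior_Ici] at hx
    rw [(hd x).deriv]
    exact mul_nonneg (le_of_lt hx) (Real.sinh_nonneg_iff.2 (le_of_lt hx))
  rcases eq_or_ne ξ 0 with rfl | hξ
  · simp [m]
  wlog hpos : 0 < ξ generalizing ξ
  · rw [← m_neg]
    exact this (-ξ) (neg_ne_zero.2 hξ) (by
      have := lt_of_le_of_ne (not_lt.1 hpos) hξ
      linarith)
  have h1 := hmono (mem_Ici.2 le_rfl) (mem_Ici.2 hpos.le) hpos.le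
  simp only [zero_mul, Real.sinh_zero, sub_zero] at h1
  have h2 : Real.tanh ξ / ξ ≤ 1 := by
    rw [Real.tanh_eq_sinh_div_cosh, div_div, div_le_one (mul_pos (Real.cosh_pos _) hpos)]
    linarith
  rw [m, if_neg hξ]
  exact Real.sqrt_le_one.2 h2

theorem symbol_ofReal (ξ : ℝ) : symbol ξ = m ξ := by
  rcases eq_or_ne ξ 0 with rfl | hξ
  · simp [symbol, tanhc_zero, m]
  have hξ' : (ξ : ℂ) ≠ 0 := by exact_mod_cast hξ
  have h1 : tanhc ξ = ((Real.tanh ξ / ξ : ℝ) : ℂ) := by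
    rw [tanhc_of_ne hξ', Real.tanh_eq_sinh_div_cosh]
    push_cast
    rw [div_div, mul_comm]
  rw [symbol, h1, m, if_neg hξ, Real.sqrt_eq_rpow, Complex.ofReal_cpow (m_sq hξ).2]
  norm_num

/-- A bound on the real line propagates to a strip through a bound on the derivative. -/
theorem norm_le_of_deriv_le {f : ℂ → ℂ} {a M x E : ℝ} (ha : 0 < a)
    (hd : ∀ z : ℂ, z.re = x → |z.im| < a → DifferentiableAt ℂ f z)
    (hM : ∀ z : ℂ, z.re = x → |z.im| < a → ‖deriv f z‖ ≤ M) (hE : ‖f x‖ ≤ E)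
    {z : ℂ} (hre : z.re = x) (hz : |z.im| < a) : ‖f z‖ ≤ E + M * a := by
  have hconv : Convex ℝ {w : ℂ | w.re = x ∧ |w.im| < a} := by
    have h1 : Convex ℝ {w : ℂ | w.re = x} := by
      have : {w : ℂ | w.re = x} = Complex.reLm ⁻¹' {x} := by ext w; simp
      rw [this]
      exact (convex_singleton x).linear_preimage _
    have h2 : Convex ℝ {w : ℂ | |w.im| < a} := by
      have : {w : ℂ | |w.im| < a} = {w : ℂ | -a < w.im} ∩ {w : ℂ | w.im < a} := by
        ext w; simp [abs_lt]
      rw [this]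
      exact (convex_halfSpace_im_gt _).inter (convex_halfSpace_im_lt _)
    exact h1.inter h2
  have h := hconv.norm_image_sub_le_of_norm_deriv_le (f := f) (C := M) (x := (x : ℂ)) (y := z)
    (fun w hw => hd w hw.1 hw.2) (fun w hw => hM w hw.1 hw.2) ⟨by simp, by simpa using ha⟩
    ⟨hre, hz⟩
  have hsub : ‖z - x‖ = |z.im| := by
    have : z - x = z.im * Complex.I := by apply Complex.ext <;> simp [hre]
    rw [this]
    simp
  have hM0 : 0 ≤ M := (norm_nonneg _).trans (hM z hre hz)
  rw [hsub] at h
  calc ‖f z‖ = ‖f x + (f z - f x)‖ := by ring_nf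
    _ ≤ ‖f x‖ + ‖f z - f x‖ := norm_add_le _ _
    _ ≤ E + M * a := add_le_add hE (h.trans (by gcongr))

/-- The factor `(2π)^{-1/2}` makes both squares equal to `1/ξ` up to `O(ξ^{-2})`, with difference at
most `3/ξ²`. Dividing by the sum of the two functions, at least `ξ^{-1/2}/2`, gives the constant
`6`. -/
theorem abs_m_sub_modelSymbolReal_le {ξ : ℝ} (hξ : 1 ≤ |ξ|) :
    |m ξ - (√(2 * Real.pi))⁻¹ * modelSymbolReal ξ| ≤ 6 * |ξ| ^ (-(3 / 2) : ℝ) := by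
  wlog hpos : 0 ≤ ξ generalizing ξ
  · have := this (ξ := -ξ) (by rwa [abs_neg]) (by linarith)
    rwa [m_neg, modelSymbolReal_neg, abs_neg] at this
  rw [abs_of_nonneg hpos] at hξ ⊢
  have hξ0 : 0 < ξ := by linarith
  set g := (√(2 * Real.pi))⁻¹ * modelSymbolReal ξ with hg
  have hg0 : 0 ≤ g := mul_nonneg (by positivity) (modelSymbolReal_nonneg ξ)
  have hm0 := m_nonneg ξ
  have hgsq : g ^ 2 = 1 / (1 + ξ ^ 2) + 1 / √(1 + ξ ^ 2) := by
    rw [hg, mul_pow, modelSymbolReal_sq, inv_pow, Real.sq_sqrt (by positivity)]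
    field_simp
  have hmsq := (m_sq hξ0.ne').1
  have ht : Real.tanh ξ = 1 - 2 / (Real.exp (2 * ξ) + 1) := by
    rw [Real.tanh_eq_sinh_div_cosh, Real.sinh_eq, Real.cosh_eq, two_mul, Real.exp_add,
      Real.exp_neg]
    have := Real.exp_pos ξ
    field_simp
    ring
  have hexp : 2 * ξ + 1 ≤ Real.exp (2 * ξ) := Real.add_one_le_exp _
  have ht1 : 2 / (Real.exp (2 * ξ) + 1) ≤ 1 / ξ := by
    rw [div_le_div_iff₀ (by positivity) hξ0]
    linarith
  have ht2 : 2 / (Real.exp (2 * ξ) + 1) ≤ 1 / 2 := by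
    rw [div_le_div_iff₀ (by positivity) (by norm_num)]
    linarith
  have ht3 : 0 ≤ 2 / (Real.exp (2 * ξ) + 1) := by positivity
  have hs1 : ξ ≤ √(1 + ξ ^ 2) := Real.le_sqrt_of_sq_le (by linarith)
  have hs2 : √(1 + ξ ^ 2) ≤ ξ + 1 := Real.sqrt_le_iff.2 ⟨by linarith, by nlinarith⟩
  have hinv1 : 1 / √(1 + ξ ^ 2) ≤ 1 / ξ := by gcongr
  have hinv2 : 1 / ξ - 1 / ξ ^ 2 ≤ 1 / √(1 + ξ ^ 2) := by
    refine le_trans ?_ (show 1 / (ξ + 1) ≤ 1 / √(1 + ξ ^ 2) by gcongr)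
    rw [div_sub_div _ _ hξ0.ne' (by positivity), div_le_div_iff₀ (by positivity) (by positivity)]
    nlinarith [sq_nonneg ξ]
  have hinv3 : 1 / (1 + ξ ^ 2) ≤ 1 / ξ ^ 2 := by gcongr; linarith
  have hinv4 : 0 ≤ 1 / (1 + ξ ^ 2) := by positivity
  have hdiff : |m ξ ^ 2 - g ^ 2| ≤ 3 / ξ ^ 2 := by
    have e1 : m ξ ^ 2 = 1 / ξ - 2 / (Real.exp (2 * ξ) + 1) / ξ := by
      rw [hmsq, ht, sub_div]
    have e2 : 2 / (Real.exp (2 * ξ) + 1) / ξ ≤ 1 / ξ ^ 2 := by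
      calc _ ≤ 1 / ξ / ξ := by gcongr
        _ = _ := by rw [div_div, sq]
    have e3 : 0 ≤ 2 / (Real.exp (2 * ξ) + 1) / ξ := by positivity
    have e4 : 3 / ξ ^ 2 = 3 * (1 / ξ ^ 2) := by ring
    have e5 : 0 ≤ 1 / ξ ^ 2 := by positivity
    rw [e1, hgsq, e4, abs_le]
    constructor <;> linarith
  have hpow : (ξ ^ (-(1 / 2) : ℝ)) ^ 2 = 1 / ξ := by
    rw [← Real.rpow_natCast, ← Real.rpow_mul hξ0.le]
    norm_num
    rw [Real.rpow_neg_one]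
  have hpow0 : 0 < ξ ^ (-(1 / 2) : ℝ) := Real.rpow_pos_of_pos hξ0 _
  have hmlow : ξ ^ (-(1 / 2) : ℝ) / 2 ≤ m ξ := by
    refine (sq_le_sq₀ (by positivity) hm0).1 ?_
    rw [div_pow, hpow, hmsq, ht, div_right_comm]
    gcongr
    linarith
  have hfac : |m ξ - g| * (m ξ + g) = |m ξ ^ 2 - g ^ 2| := by
    rw [show m ξ ^ 2 - g ^ 2 = (m ξ - g) * (m ξ + g) by ring, abs_mul,
      abs_of_nonneg (add_nonneg hm0 hg0)]
  have h1 : |m ξ - g| * (ξ ^ (-(1 / 2) : ℝ) / 2) ≤ 3 / ξ ^ 2 := by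
    refine le_trans ?_ (hfac.trans_le hdiff)
    gcongr
    linarith
  have h2 : 3 / ξ ^ 2 = 6 * ξ ^ (-(3 / 2) : ℝ) * (ξ ^ (-(1 / 2) : ℝ) / 2) := by
    rw [show 6 * ξ ^ (-(3 / 2) : ℝ) * (ξ ^ (-(1 / 2) : ℝ) / 2) =
      3 * (ξ ^ (-(3 / 2) : ℝ) * ξ ^ (-(1 / 2) : ℝ)) by ring, ← Real.rpow_add hξ0]
    norm_num
    ring
  rw [h2] at h1
  exact le_of_mul_le_mul_right h1 (by positivity)

/-! ### Kernels for `m` and `m / (c - m)` -/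

/-- The Whitham symbol is the Fourier transform of an exponentially decaying kernel. -/
theorem exists_isExpKernel_m : ∃ δ h, IsExpKernel δ h m := by
  set κ : ℝ := (√(2 * Real.pi))⁻¹ with hκ
  have hpi : Real.pi / 4 < 1 := by linarith [Real.pi_lt_four]
  have hpi0 : 0 < Real.pi / 4 := by linarith [Real.pi_pos]
  have hopen : IsOpen {z : ℂ | |z.im| < Real.pi / 4} :=
    isOpen_lt (by fun_prop) continuous_const
  have hdm : ∀ z : ℂ, |z.im| < Real.pi / 4 → DifferentiableAt ℂ symbol z := fun z hz =>
    differentiableOn_symbol.differentiableAt (hopen.mem_nhds hz)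
  have hdg : ∀ z : ℂ, |z.im| < Real.pi / 4 → DifferentiableAt ℂ modelSymbol z := fun z hz => by
    obtain ⟨d, hd, -⟩ := exists_hasDerivAt_modelSymbol (hz.trans hpi)
    exact hd.differentiableAt
  have hdS : ∀ z : ℂ, |z.im| < Real.pi / 4 →
      DifferentiableAt ℂ (fun z => symbol z - κ * modelSymbol z) z := fun z hz =>
    (hdm z hz).fun_sub ((hdg z hz).const_mul _)
  -- The bound of order `-3/2` on the line extends to the strip: a vertical move of length below
  -- `π/4` costs a derivative of the same order.
  have hex : ∃ δ b, IsExpKernel δ b fun ξ => m ξ - κ * modelSymbolReal ξ := by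
    refine exists_isExpKernel (S := fun z => symbol z - κ * modelSymbol z) (a := Real.pi / 4)
      (C := 6 + (3 / 2 + |κ| * √Real.pi) * (Real.pi / 4)) hpi0
      (fun z hz => (hdS z hz).differentiableWithinAt) ?_ ?_ ?_
    · intro z hz hre
      have hre0 : 0 < |z.re| := by linarith
      have := norm_le_of_deriv_le (f := fun z => symbol z - κ * modelSymbol z) (x := z.re)
        (M := (3 / 2 + |κ| * √Real.pi) * |z.re| ^ (-(3 / 2) : ℝ))
        (E := 6 * |z.re| ^ (-(3 / 2) : ℝ)) hpi0 (fun w _ hw => hdS w hw) ?_ ?_ rfl hz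
      · refine this.trans (le_of_eq ?_)
        ring
      · intro w hw hwi
        obtain ⟨d, hd, hdb⟩ := exists_hasDerivAt_modelSymbol (hwi.trans hpi)
        rw [deriv_fun_sub (hdm w hwi) ((hdg w hwi).const_mul _), deriv_const_mul _ (hdg w hwi),
          hd.deriv]
        rw [← hw] at hre0 ⊢
        have h1 := norm_deriv_symbol_le hwi hre0
        have h2 := hdb hre0
        refine (norm_sub_le _ _).trans ?_
        rw [norm_mul, Complex.norm_real, Real.norm_eq_abs, add_mul, mul_assoc |κ|]
        gcongr
      · simp only [symbol_ofReal, modelSymbol_ofReal]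
        rw [← Complex.ofReal_mul, ← Complex.ofReal_sub, Complex.norm_real, Real.norm_eq_abs]
        exact abs_m_sub_modelSymbolReal_le hre
    · intro ξ
      simp only [symbol_ofReal, modelSymbol_ofReal]
      push_cast
      ring
    · intro ξ
      simp only [m_neg, modelSymbolReal_neg]
  obtain ⟨δ, b, hb⟩ := hex
  have hg := isExpKernel_modelKernel.const_mul κ
  have hδ := hb.pos
  have := (hb.mono (δ' := min δ (1 / 2)) (by positivity) (min_le_left _ _)).add
    (hg.mono (by positivity) (min_le_right _ _))
  simp only [sub_add_cancel] at this
  exact ⟨_, _, this⟩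

/-- On the line the symbol is at most `1`, and its derivative is bounded in a strip, so a thin
enough strip keeps it below the midpoint of `1` and `c`. This keeps `c - symbol` away from zero. -/
theorem exists_norm_symbol_le {c : ℝ} (hc : 1 < c) :
    ∃ a, 0 < a ∧ a < Real.pi / 4 ∧ ∀ z : ℂ, |z.im| < a → ‖symbol z‖ ≤ (c + 1) / 2 := by
  have hpi0 : 0 < Real.pi / 8 := by linarith [Real.pi_pos]
  have hpi : Real.pi / 8 < Real.pi / 4 := by linarith [Real.pi_pos]
  have hopen : IsOpen {z : ℂ | |z.im| < Real.pi / 4} :=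
    isOpen_lt (by fun_prop) continuous_const
  obtain ⟨B, hB0, hB⟩ := exists_norm_le_one_add_rpow (S := deriv symbol) (r := 3 / 2) hpi
    (by norm_num) (differentiableOn_symbol.deriv hopen).continuousOn
    fun z hz hre => norm_deriv_symbol_le hz (by linarith)
  set a := min (Real.pi / 8) ((c - 1) / (2 * (B + 1))) with ha
  have ha0 : 0 < a := lt_min hpi0 (div_pos (by linarith) (by positivity))
  have ha1 : a ≤ Real.pi / 8 := min_le_left _ _
  refine ⟨a, ha0, by linarith, fun z hz => ?_⟩
  have := norm_le_of_deriv_le (f := symbol) (x := z.re) (M := B) (E := 1) ha0 ?_ ?_ ?_ rfl hz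
  · have h1 : B * a ≤ (c - 1) / 2 := by
      calc B * a ≤ (B + 1) * ((c - 1) / (2 * (B + 1))) := by
            gcongr
            · linarith
            · exact min_le_right _ _
        _ = (c - 1) / 2 := by field_simp
    linarith
  · exact fun w _ hw => differentiableOn_symbol.differentiableAt
      (hopen.mem_nhds (show |w.im| < Real.pi / 4 by linarith))
  · intro w _ hw
    refine (hB w (by linarith)).trans (mul_le_of_le_one_right hB0 ?_)
    exact Real.rpow_le_one_of_one_le_of_nonpos (by linarith [abs_nonneg w.re]) (by norm_num)
  · rw [symbol_ofReal, Complex.norm_real, Real.norm_of_nonneg (m_nonneg _)]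
    exact m_le_one _

/-- The cube is the first power of `m` whose decay, of order `-3/2`, meets the requirement of
`exists_isExpKernel`. -/
theorem exists_isExpKernel_cube {c : ℝ} (hc : 1 < c) :
    ∃ δ h, IsExpKernel δ h fun ξ => m ξ ^ 3 / (c ^ 2 * (c - m ξ)) := by
  obtain ⟨a, ha0, hapi, ha⟩ := exists_norm_symbol_le hc
  have hlow : ∀ z : ℂ, |z.im| < a → (c - 1) / 2 ≤ ‖(c : ℂ) - symbol z‖ := by
    intro z hz
    have h1 := norm_sub_norm_le (c : ℂ) (symbol z)
    rw [Complex.norm_real, Real.norm_of_nonneg (by linarith)] at h1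
    linarith [ha z hz]
  have hne : ∀ z : ℂ, |z.im| < a → (c : ℂ) ^ 2 * (c - symbol z) ≠ 0 := by
    intro z hz h
    rcases mul_eq_zero.1 h with h | h
    · have : c = 0 := by exact_mod_cast pow_eq_zero_iff (two_ne_zero) |>.1 h
      linarith
    · have := hlow z hz
      rw [h, norm_zero] at this
      linarith
  have hd : DifferentiableOn ℂ symbol {z | |z.im| < a} :=
    differentiableOn_symbol.mono fun z (hz : |z.im| < a) => hz.trans hapi
  refine exists_isExpKernel (S := fun z => symbol z ^ 3 / (c ^ 2 * (c - symbol z)))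
    (C := 1 / (c ^ 2 * ((c - 1) / 2))) ha0 ?_ ?_ ?_ ?_
  · exact (hd.pow 3).div ((hd.const_sub _).const_mul _) hne
  · intro z hz hre
    have hre0 : 0 < |z.re| := by linarith
    have h1 := norm_symbol_le (hz.trans hapi) hre0
    have h2 : (|z.re| ^ (-(1 / 2) : ℝ)) ^ 3 = |z.re| ^ (-(3 / 2) : ℝ) := by
      rw [← Real.rpow_natCast, ← Real.rpow_mul hre0.le]
      norm_num
    rw [norm_div, norm_pow, norm_mul, norm_pow, Complex.norm_real,
      Real.norm_of_nonneg (by linarith), div_eq_mul_inv, mul_comm, one_div]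
    have h3 : 0 < c ^ 2 * ((c - 1) / 2) := mul_pos (by positivity) (by linarith)
    refine mul_le_mul ?_ ?_ (by positivity) (by positivity)
    · gcongr
      exact hlow z hz
    · rw [← h2]
      gcongr
  · intro ξ
    simp only [symbol_ofReal]
    push_cast
    ring
  · intro ξ
    simp only [m_neg]

/-- The symbol `m / (c - m)` is the Fourier transform of an exponentially decaying kernel. -/
theorem exists_isExpKernel_div {c : ℝ} (hc : 1 < c) :
    ∃ δ h, IsExpKernel δ h fun ξ => m ξ / (c - m ξ) := by
  obtain ⟨δ₁, k, hk⟩ := exists_isExpKernel_m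
  obtain ⟨δ₂, q, hq⟩ := exists_isExpKernel_cube hc
  have h1 := hk.pos
  have h2 := hq.pos
  have hk' := hk.mono (δ' := min δ₁ δ₂) (by positivity) (min_le_left _ _)
  have hq' := hq.mono (δ' := min δ₁ δ₂) (by positivity) (min_le_right _ _)
  have h := ((hk'.const_mul (1 / c)).add ((hk'.conv hk').const_mul (1 / c ^ 2))).add hq'
  -- Geometric expansion in `m / c`, stopped after two terms.
  have hs : (fun ξ => m ξ / (c - m ξ)) = fun ξ =>
      1 / c * m ξ + 1 / c ^ 2 * (m ξ * m ξ) + m ξ ^ 3 / (c ^ 2 * (c - m ξ)) := by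
    ext ξ
    have h3 : c - m ξ ≠ 0 := by linarith [m_le_one ξ]
    have h4 : c ≠ 0 := by linarith
    field_simp
    ring
  exact ⟨_, _, hs ▸ h⟩

theorem conv_congr_ae {f g : ℝ → ℝ} (h : f =ᵐ[volume] g) (φ : ℝ → ℝ) : conv f φ = conv g φ := by
  ext x
  rw [conv_apply, conv_apply]
  exact integral_congr_ae (h.mono fun y hy => by simp only [hy])

theorem exists_isDecayRate {c : ℝ} (hc : 1 < c) : ∃ δ, IsDecayRate c δ := by
  obtain ⟨δ, h, hh⟩ := exists_isExpKernel_div hc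
  have hpos := hh.pos
  have hh' := hh.mono (δ' := min δ 1) (by positivity) (min_le_left _ _)
  -- The cap at `1` ensures a rate below `π/2`; the halving is the loss in `memLp_two`.
  refine ⟨min δ 1 / 2, half_pos hh'.pos, ?_, ?_⟩
  · have := min_le_right δ 1
    linarith [Real.pi_gt_three]
  · refine hh'.memLp_two.ae_eq ?_
    filter_upwards [hh.ae_eq_inverseFourier] with x hx
    rw [H, hx]

/-- Bounded solutions of the steady equation satisfy the convolution form of the equation. -/
theorem IsSteadySolution.isConvolutionSolution {c : ℝ} (hc : 1 < c) {φ : ℝ → ℝ}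
    (hφ : IsSteadySolution c φ) : IsConvolutionSolution c φ where
  continuous := hφ.continuous
  bounded := hφ.bounded
  equation := by
    obtain ⟨δ₁, k, hk⟩ := exists_isExpKernel_m
    obtain ⟨δ₂, h, hh⟩ := exists_isExpKernel_div hc
    obtain ⟨C, hC⟩ := hφ.bounded
    have h1 := hk.pos
    have h2 := hh.pos
    have hk' := hk.mono (δ' := min δ₁ δ₂) (by positivity) (min_le_left _ _)
    have hh' := hh.mono (δ' := min δ₁ δ₂) (by positivity) (min_le_right _ _)
    -- On the Fourier side this is the kernel identity `h * k = c h - k`.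
    have hs : (fun ξ => c * (m ξ / (c - m ξ)) + -1 * m ξ) =
        fun ξ => m ξ / (c - m ξ) * m ξ := by
      ext ξ
      have h3 : c - m ξ ≠ 0 := by linarith [m_le_one ξ]
      field_simp
      ring
    have hsum := (hh'.const_mul c).add (hk'.const_mul (-1))
    rw [hs] at hsum
    have hae := (hh'.conv hk').isInverseFourier.ae_eq hsum.isInverseFourier
    intro x
    rw [H, conv_congr_ae hh.ae_eq_inverseFourier]
    refine mul_sub_eq_conv_sq hh.integrable hk.integrable ?_ hφ.continuous hC (fun y => ?_) x
    · filter_upwards [hae] with y hy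
      rw [hy]
      ring
    · rw [← conv_congr_ae hk.ae_eq_inverseFourier]
      exact hφ.equation y

end

end Whitham

theorem mainTheorem2 (c : ℝ) (hc : 1 < c) :
    (∃ δ : ℝ, Whitham.IsDecayRate c δ) ∧
    ∀ δ : ℝ, Whitham.IsDecayRate c δ →
      ∀ φ : ℝ → ℝ,
        (Whitham.IsSteadySolution c φ ∨ Whitham.IsConvolutionSolution c φ) →
        Filter.Tendsto φ (Filter.cocompact ℝ) (nhds 0) →
        ∃ ν : ℝ, 0 < ν ∧ ν < δ ∧
          MeasureTheory.MemLp (fun x : ℝ => Real.exp (ν * |x|) * φ x) 1 MeasureTheory.volume ∧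
          MeasureTheory.MemLp (fun x : ℝ => Real.exp (ν * |x|) * φ x) ⊤ MeasureTheory.volume := by
  refine ⟨Whitham.exists_isDecayRate hc, fun δ hδ φ hφ hlim => ?_⟩
  have hsol : Whitham.IsConvolutionSolution c φ :=
    hφ.elim (fun h => h.isConvolutionSolution hc) id
  obtain ⟨δ₀, h, hh⟩ := Whitham.exists_isExpKernel_div hc
  obtain ⟨C, hC⟩ := hsol.bounded
  obtain ⟨B, hB⟩ := Whitham.exp_mul_abs_le_of_conv_sq (by linarith) hh.pos hh.integrable_exp hC
    (fun x => by
      rw [← Whitham.conv_congr_ae hh.ae_eq_inverseFourier]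
      exact hsol.equation x) hlim
  -- The exponent must lie strictly below both the rate `δ₀` proved for `φ` and the prescribed `δ`.
  have hmin : 0 < min δ₀ δ := lt_min hh.pos hδ.1
  have h1 : min δ₀ δ / 2 < δ₀ := by linarith [min_le_left δ₀ δ]
  have h2 : min δ₀ δ / 2 < δ := by linarith [min_le_right δ₀ δ]
  exact ⟨min δ₀ δ / 2, half_pos hmin, h2,
    Whitham.memLp_exp_mul_of_exp_mul_abs_le h1 hsol.continuous hB⟩
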